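/- Throughout, $\mathcal{P}$ is one of two categories with objects the real numbers $\ell>0$: either $\mathcal{P}=\mathcal{G}$, where $\mathcal{G}(\ell,\ell')$ is the set of nondecreasing homeomorphisms $[0,\ell]\to[0,\ell']$, or $\mathcal{P}=\mathcal{M}$, where $\mathcal{M}(\ell,\ell')$ is the set of nondecreasing surjective (hence continuous) maps $[0,\ell]\to[0,\ell']$. Put $\mu_\ell:[0,\ell]\to[0,1]$, $\mu_\ell(t)=t/\ell$. For $\psi_i\in\mathcal{P}(\ell_i,\ell'_i)$, $1\le i\le n$, the map $\psi_1\otimes\dots\otimes\psi_n\in\mathcal{P}(\sum_i\ell_i,\sum_i\ell'_i)$ is given by $t\mapsto \psi_i(t-\sum_{j<i}\ell_j)+\sum_{j<i}\ell'_j$ for $\sum_{j<i}\ell_j\le t\le\sum_{j\le i}\ell_j$. For composable continuous maps $p_i:[0,\ell_i]\to U$, the Moore composition $p_1*\dots*p_n:[0,\sum_i\ell_i]\to U$ is $t\mapsto p_i(t-\sum_{j<i}\ell_j)$ on the same intervals. A Moore path is a nonconstant continuous map $[0,\ell]\to U$ with $\ell>0$; it is regular if there is no maximal nontrivial interval $[a,b]$,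 $a<b$, on which it is constant. Let $\mathbf{Top}$ be the category of $\Delta$-generated spaces, or that of $\Delta$-Hausdorff $\Delta$-generated spaces. A $\mathcal{P}$-multipointed $d$-space is a triple $(|X|,X^0,\mathbb{P}X)$ of a space $|X|$ of $\mathbf{Top}$, a set of states $X^0\subseteq|X|$ and a set $\mathbb{P}X$ of continuous maps $[0,1]\to|X|$ (the execution paths) with endpoints in $X^0$, stable under precomposition with $\mathcal{P}(1,1)$ and under the normalized composition of composable paths. A map is a continuous map preserving states and execution paths. A set $E$ is identified with $(E,E,\varnothing)$, where $E$ is discrete. The globe $\mathrm{Glob}^{\mathcal{P}}(Z)$ has underlying space the quotient of $\{0,1\}\sqcup(Z\times[0,1])$ by $(z,0)=0$, $(z,1)=1$, states $0,1$, and execution paths $\delta_z\phi$ with $z\in Z$, $\phi\in\mathcal{P}(1,1)$, where $\delta_z(t)=(z,t)$. Let $\mathbf{D}^n$ be the closed unit disk of $\mathbb{R}^n$ and $\mathbf{S}^{n-1}$ its boundary sphere ($\mathbf{D}^0$ is a point and $\mathbf{S}^{-1}=\varnothing$). Let $X_\lambda$ be a cellular $\mathcal{P}$-multipointed $d$-space: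 $\lambda$ is an ordinal, and there is a tower $(X_\nu)_{\nu\le\lambda}$ of $\mathcal{P}$-multipointed $d$-spaces which is colimit-preserving at limit ordinals, such that $X_0$ is a set and, for every $\nu<\lambda$, $X_{\nu+1}$ is the pushout of the map $\mathrm{Glob}^{\mathcal{P}}(\mathbf{S}^{n_\nu-1})\to\mathrm{Glob}^{\mathcal{P}}(\mathbf{D}^{n_\nu})$ induced by the inclusion along a map $g_\nu:\mathrm{Glob}^{\mathcal{P}}(\mathbf{S}^{n_\nu-1})\to X_\nu$, with $n_\nu\ge0$. Let $\widehat{g_\nu}:\mathrm{Glob}^{\mathcal{P}}(\mathbf{D}^{n_\nu})\to X_{\nu+1}\to X_\lambda$ be the resulting map. **Theorem.** Let $\gamma$ be an execution path of $X_\lambda$. It can be decomposed as a Moore composition $$\gamma=(\widehat{g_{\nu_1}}\delta_{z_1}\phi_1\mu_{\ell_1})*\dots*(\widehat{g_{\nu_n}}\delta_{z_n}\phi_n\mu_{\ell_n})$$ with $n\ge1$, $\nu_i<\lambda$, $z_i\in\mathbf{D}^{n_{\nu_i}}\setminus\mathbf{S}^{n_{\nu_i}-1}$, $\phi_i\in\mathcal{P}(1,1)$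 and $\ell_i>0$ for all $i$, and $\ell_1+\dots+\ell_n=1$. If $$\gamma=(\widehat{g_{\nu'_1}}\delta_{z'_1}\phi'_1\mu_{\ell'_1})*\dots*(\widehat{g_{\nu'_{n'}}}\delta_{z'_{n'}}\phi'_{n'}\mu_{\ell'_{n'}})$$ is a second such decomposition, then $n=n'$, $\nu_i=\nu'_i$ and $z_i=z'_i$ for all $1\le i\le n$, and $$(\phi_1\mu_{\ell_1})\otimes\dots\otimes(\phi_n\mu_{\ell_n})=(\phi'_1\mu_{\ell'_1})\otimes\dots\otimes(\phi'_n\mu_{\ell'_n})\in\mathcal{P}(1,n).$$ Consequently the globular naturalization $(\widehat{g_{\nu_1}}\delta_{z_1})*\dots*(\widehat{g_{\nu_n}}\delta_{z_n})$ of $\gamma$ is a well-defined Moore path of length $n$, which is regular, and the carrier of $\gamma$, the sequence of cells with indices $[\nu_1,\dots,\nu_n]$, is well defined: neither depends on the chosen decomposition. -/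

import Mathlib

open CategoryTheory CategoryTheory.Limits Topology

universe w u

/-! ### The two reparametrization categories -/

/-- The segment `[0, ℓ]`. -/
abbrev Seg (ℓ : ℝ) : Type := Set.Icc (0 : ℝ) ℓ

/-- The two possible choices of the reparametrization category `𝒫`. -/
inductive Reparam
  | G
  | M

/-- Membership in `𝒫(ℓ, ℓ')`: for `𝒢` the nondecreasing homeomorphisms `[0, ℓ] → [0, ℓ']`, for
`ℳ` the nondecreasing surjective (continuous) maps `[0, ℓ] → [0, ℓ']`. -/
def Reparam.IsReparam (P : Reparam) {ℓ ℓ' : ℝ} (φ : C(Seg ℓ, Seg ℓ')) : Prop :=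
  match P with
  | .G => Monotone φ ∧ IsHomeomorph φ
  | .M => Monotone φ ∧ Function.Surjective φ

/-- The set of maps `𝒫(ℓ, ℓ')`. -/
def Reparam.Hom (P : Reparam) (ℓ ℓ' : ℝ) : Type :=
  {φ : C(Seg ℓ, Seg ℓ') // P.IsReparam φ}

namespace Reparam

variable {P : Reparam} {ℓ ℓ' ℓ'' : ℝ}

theorem isReparam_of_bijective {φ : C(Seg ℓ, Seg ℓ')} (h : Monotone φ)
    (hb : Function.Bijective φ) : P.IsReparam φ := by
  cases P
  · exact ⟨h, isHomeomorph_iff_continuous_bijective.2 ⟨φ.continuous, hb⟩⟩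
  · exact ⟨h, hb.2⟩

theorem IsReparam.monotone {φ : C(Seg ℓ, Seg ℓ')} (h : P.IsReparam φ) : Monotone φ := by
  cases P <;> exact h.1

theorem IsReparam.surjective {φ : C(Seg ℓ, Seg ℓ')} (h : P.IsReparam φ) :
    Function.Surjective φ := by
  cases P
  · exact h.2.surjective
  · exact h.2

theorem IsReparam.comp {ψ : C(Seg ℓ', Seg ℓ'')} {φ : C(Seg ℓ, Seg ℓ')} (hψ : P.IsReparam ψ)
    (hφ : P.IsReparam φ) : P.IsReparam (ψ.comp φ) := by
  cases P
  · exact ⟨hψ.1.comp hφ.1, hψ.2.comp hφ.2⟩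
  · exact ⟨hψ.1.comp hφ.1, hψ.2.comp hφ.2⟩

theorem IsReparam.map_zero {φ : C(Seg ℓ, Seg ℓ')} (h : P.IsReparam φ) (t : Seg ℓ)
    (ht : (t : ℝ) ≤ 0) : (φ t : ℝ) = 0 := by
  have h0 : (0 : ℝ) ≤ ℓ' := (φ t).2.1.trans (φ t).2.2
  obtain ⟨s, hs⟩ := h.surjective ⟨0, le_rfl, h0⟩
  have h1 : φ t ≤ φ s := h.monotone (Subtype.coe_le_coe.1 (ht.trans s.2.1))
  rw [hs] at h1
  exact le_antisymm h1 (φ t).2.1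

theorem IsReparam.map_last {φ : C(Seg ℓ, Seg ℓ')} (h : P.IsReparam φ) (t : Seg ℓ)
    (ht : ℓ ≤ t) : (φ t : ℝ) = ℓ' := by
  have h0 : (0 : ℝ) ≤ ℓ' := (φ t).2.1.trans (φ t).2.2
  obtain ⟨s, hs⟩ := h.surjective ⟨ℓ', h0, le_rfl⟩
  have h1 : φ s ≤ φ t := h.monotone (Subtype.coe_le_coe.1 (s.2.2.trans ht))
  rw [hs] at h1
  exact le_antisymm (φ t).2.2 h1

/-- Composition in `𝒫`. -/
def Hom.comp (ψ : P.Hom ℓ' ℓ'') (φ : P.Hom ℓ ℓ') : P.Hom ℓ ℓ'' :=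
  ⟨ψ.1.comp φ.1, ψ.2.comp φ.2⟩

variable (P) in
/-- The homeomorphism `μ_ℓ : [0, ℓ] → [0, 1]`, `t ↦ t / ℓ`, as a map of `𝒫`. -/
noncomputable def mu (ℓ : ℝ) (hℓ : 0 < ℓ) : P.Hom ℓ 1 :=
  ⟨⟨fun t => ⟨(t : ℝ) / ℓ, div_nonneg t.2.1 hℓ.le, (div_le_one hℓ).2 t.2.2⟩, by fun_prop⟩, by
    refine isReparam_of_bijective (fun s t h => ?_) ⟨fun s t h => ?_, fun t => ?_⟩
    · exact Subtype.coe_le_coe.1 (div_le_div_of_nonneg_right h hℓ.le)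
    · have h1 : (s : ℝ) / ℓ = t / ℓ := congrArg Subtype.val h
      exact Subtype.ext ((div_left_inj' hℓ.ne').1 h1)
    · refine ⟨⟨t * ℓ, mul_nonneg t.2.1 hℓ.le, mul_le_of_le_one_left hℓ.le t.2.2⟩, ?_⟩
      exact Subtype.ext (mul_div_cancel_right₀ _ hℓ.ne')⟩

end Reparam

/-! ### Tensor products of reparametrizations and Moore compositions -/

/-- The partial sum `∑_{j < i} ℓ_j`. -/
noncomputable def partialSum {n : ℕ} (ℓ : Fin n → ℝ) (i : Fin n) : ℝ := ∑ j ∈ Finset.Iio i, ℓ j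

section PartialSum

variable {n : ℕ} {ℓ : Fin n → ℝ}

theorem partialSum_nonneg (hℓ : ∀ i, 0 ≤ ℓ i) (i : Fin n) : 0 ≤ partialSum ℓ i :=
  Finset.sum_nonneg fun j _ => hℓ j

theorem partialSum_add (i : Fin n) : partialSum ℓ i + ℓ i = ∑ j ∈ Finset.Iic i, ℓ j := by
  rw [partialSum, ← Finset.Iio_insert, Finset.sum_insert (by simp), add_comm]

theorem partialSum_add_le (hℓ : ∀ i, 0 ≤ ℓ i) {i j : Fin n} (h : i < j) :
    partialSum ℓ i + ℓ i ≤ partialSum ℓ j := by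
  rw [partialSum_add]
  refine Finset.sum_le_sum_of_subset_of_nonneg (fun k hk => ?_) fun k _ _ => hℓ k
  simp only [Finset.mem_Iic, Finset.mem_Iio] at hk ⊢
  exact lt_of_le_of_lt hk h

theorem partialSum_add_le_sum (hℓ : ∀ i, 0 ≤ ℓ i) (i : Fin n) :
    partialSum ℓ i + ℓ i ≤ ∑ j, ℓ j := by
  rw [partialSum_add]
  exact Finset.sum_le_sum_of_subset_of_nonneg (Finset.subset_univ _) fun k _ _ => hℓ k

theorem exists_partialSum_le_lt (s : ℝ) (h0 : 0 ≤ s) (h1 : s < ∑ j, ℓ j) :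
    ∃ i, partialSum ℓ i ≤ s ∧ s < partialSum ℓ i + ℓ i := by
  by_contra! hcon
  have key : ∀ (k : ℕ) (hk : k ≤ n), ∑ j ∈ Finset.univ.filter (fun j : Fin n => j.1 < k), ℓ j ≤ s := by
    intro k
    induction k with
    | zero => intro _; simpa using h0
    | succ k ih =>
      intro hk
      have h2 := hcon ⟨k, hk⟩
      rw [partialSum_add] at h2
      have e1 : partialSum ℓ ⟨k, hk⟩ = ∑ j ∈ Finset.univ.filter (fun j : Fin n => j.1 < k), ℓ j := by
        refine Finset.sum_congr ?_ fun _ _ => rfl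
        ext j; simp [Fin.lt_def]
      have e2 : ∑ j ∈ Finset.Iic (⟨k, hk⟩ : Fin n), ℓ j
          = ∑ j ∈ Finset.univ.filter (fun j : Fin n => j.1 < k + 1), ℓ j := by
        refine Finset.sum_congr ?_ fun _ _ => rfl
        ext j; simp [Fin.le_def]
      rw [← e2]
      exact h2 (e1 ▸ ih (by omega))
  have h3 := key n le_rfl
  rw [Finset.filter_true_of_mem fun j _ => j.2] at h3
  exact absurd h1 (not_lt.2 h3)

end PartialSum

namespace Reparam

variable {P : Reparam} {n : ℕ} {ℓ ℓ' : Fin n → ℝ} {L L' : ℝ}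

/-- The underlying function of `φ₁ ⊗ ⋯ ⊗ φₙ`, written as the sum of the increments of the `φᵢ`:
at a time of the `i`-th segment the earlier terms equal `ℓ'_j` and the later ones vanish. The
piecewise description is `Reparam.tensor_apply`. -/
noncomputable def tensorFun (hℓ : ∀ i, 0 < ℓ i) (φ : ∀ i, P.Hom (ℓ i) (ℓ' i)) (s : ℝ) : ℝ :=
  ∑ i, ((φ i).1 (Set.projIcc 0 (ℓ i) (hℓ i).le (s - partialSum ℓ i)) : ℝ)

theorem continuous_tensorFun (hℓ : ∀ i, 0 < ℓ i) (φ : ∀ i, P.Hom (ℓ i) (ℓ' i)) :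
    Continuous (tensorFun hℓ φ) := by
  refine continuous_finsetSum _ fun i _ => ?_
  exact continuous_subtype_val.comp ((φ i).1.continuous.comp
    (continuous_projIcc.comp (by fun_prop)))

theorem term_mono (hℓ : ∀ i, 0 < ℓ i) (φ : ∀ i, P.Hom (ℓ i) (ℓ' i)) {s t : ℝ} (h : s ≤ t)
    (i : Fin n) :
    ((φ i).1 (Set.projIcc 0 (ℓ i) (hℓ i).le (s - partialSum ℓ i)) : ℝ)
      ≤ (φ i).1 (Set.projIcc 0 (ℓ i) (hℓ i).le (t - partialSum ℓ i)) :=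
  Subtype.coe_le_coe.2 ((φ i).2.monotone (Set.monotone_projIcc _ (by linarith)))

theorem term_zero (hℓ : ∀ i, 0 < ℓ i) (φ : ∀ i, P.Hom (ℓ i) (ℓ' i)) {s : ℝ} (i : Fin n)
    (h : s ≤ partialSum ℓ i) :
    ((φ i).1 (Set.projIcc 0 (ℓ i) (hℓ i).le (s - partialSum ℓ i)) : ℝ) = 0 := by
  apply (φ i).2.map_zero
  rw [Set.projIcc_of_le_left _ (by linarith)]

theorem term_last (hℓ : ∀ i, 0 < ℓ i) (φ : ∀ i, P.Hom (ℓ i) (ℓ' i)) {s : ℝ} (i : Fin n)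
    (h : partialSum ℓ i + ℓ i ≤ s) :
    ((φ i).1 (Set.projIcc 0 (ℓ i) (hℓ i).le (s - partialSum ℓ i)) : ℝ) = ℓ' i := by
  apply (φ i).2.map_last
  rw [Set.projIcc_of_right_le _ (by linarith)]

/-- The tensor product `φ₁ ⊗ ⋯ ⊗ φₙ ∈ 𝒫(L, L')` of maps `φᵢ ∈ 𝒫(ℓᵢ, ℓ'ᵢ)`, where `L = ∑ ℓᵢ` and
`L' = ∑ ℓ'ᵢ`. -/
noncomputable def tensor (hℓ : ∀ i, 0 < ℓ i) (φ : ∀ i, P.Hom (ℓ i) (ℓ' i))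
    (hL : ∑ i, ℓ i = L) (hL' : ∑ i, ℓ' i = L') : P.Hom L L' :=
  ⟨⟨fun s => ⟨tensorFun hℓ φ s, Finset.sum_nonneg fun i _ => ((φ i).1 _).2.1,
      hL' ▸ Finset.sum_le_sum fun i _ => ((φ i).1 _).2.2⟩,
      ((continuous_tensorFun hℓ φ).comp continuous_subtype_val).subtype_mk _⟩, by
    have hmono : Monotone fun s : Seg L => tensorFun hℓ φ s := fun s t h =>
      Finset.sum_le_sum fun i _ => term_mono hℓ φ h i
    have hL0 : 0 ≤ L := hL ▸ Finset.sum_nonneg fun i _ => (hℓ i).le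
    have h0 : tensorFun hℓ φ 0 = 0 := Finset.sum_eq_zero fun i _ =>
      term_zero hℓ φ i (partialSum_nonneg (fun i => (hℓ i).le) i)
    have h1 : tensorFun hℓ φ L = L' := by
      rw [← hL']
      refine Finset.sum_congr rfl fun i _ => term_last hℓ φ i ?_
      rw [← hL]
      exact partialSum_add_le_sum (fun i => (hℓ i).le) i
    have hsurj : ∀ y : Seg L', ∃ s : Seg L, tensorFun hℓ φ s = y := by
      intro y
      have := intermediate_value_Icc hL0 (continuous_tensorFun hℓ φ).continuousOn
      rw [h0, h1] at this
      obtain ⟨s, hs, hy⟩ := this y.2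
      exact ⟨⟨s, hs⟩, hy⟩
    cases P with
    | M => exact ⟨fun s t h => hmono h, fun y => (hsurj y).imp fun s hs => Subtype.ext hs⟩
    | G =>
      refine isReparam_of_bijective (fun s t h => hmono h)
        ⟨?_, fun y => (hsurj y).imp fun s hs => Subtype.ext hs⟩
      have hlt : ∀ s t : Seg L, s < t → tensorFun hℓ φ s ≠ tensorFun hℓ φ t := by
        intro s t hst heq
        have hst' : (s : ℝ) < t := hst
        obtain ⟨i, hi1, hi2⟩ := exists_partialSum_le_lt (ℓ := ℓ) (s : ℝ) s.2.1
          (lt_of_lt_of_le hst' (t.2.2.trans hL.ge))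
        have h2 := (Finset.sum_eq_sum_iff_of_le
          fun i _ => term_mono hℓ φ hst'.le i).1 heq i (Finset.mem_univ i)
        have h3 := (φ i).2.2.injective (Subtype.ext h2)
        have h4 := congrArg Subtype.val h3
        simp only [Set.coe_projIcc] at h4
        rw [min_eq_right (by linarith), max_eq_right (by linarith)] at h4
        have h5 : (s : ℝ) - partialSum ℓ i < min (ℓ i) ((t : ℝ) - partialSum ℓ i) :=
          lt_min (by linarith) (by linarith)
        have h6 := le_max_right (0 : ℝ) (min (ℓ i) ((t : ℝ) - partialSum ℓ i))
        linarith
      intro s t h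
      have h' : tensorFun hℓ φ s = tensorFun hℓ φ t := congrArg Subtype.val h
      rcases lt_trichotomy s t with hst | hst | hst
      · exact absurd h' (hlt s t hst)
      · exact hst
      · exact absurd h'.symm (hlt t s hst)⟩

/-- The defining piecewise formula of the tensor product:
`(φ₁ ⊗ ⋯ ⊗ φₙ)(∑_{j < i} ℓ_j + t) = ∑_{j < i} ℓ'_j + φᵢ(t)` for `t ∈ [0, ℓᵢ]`. -/
theorem tensor_apply (hℓ : ∀ i, 0 < ℓ i) (φ : ∀ i, P.Hom (ℓ i) (ℓ' i))
    (hL : ∑ i, ℓ i = L) (hL' : ∑ i, ℓ' i = L') (i : Fin n) (t : Seg (ℓ i)) (s : Seg L)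
    (hs : (s : ℝ) = partialSum ℓ i + t) :
    ((tensor hℓ φ hL hL').1 s : ℝ) = partialSum ℓ' i + (φ i).1 t := by
  change tensorFun hℓ φ s = _
  have h0 : ∀ i, 0 ≤ ℓ i := fun i => (hℓ i).le
  have hterm : ∀ j, ((φ j).1 (Set.projIcc 0 (ℓ j) (hℓ j).le (s - partialSum ℓ j)) : ℝ)
      = (if j < i then ℓ' j else 0) + (if j = i then ((φ i).1 t : ℝ) else 0) := by
    intro j
    rcases lt_trichotomy j i with h | h | h
    · rw [if_pos h, if_neg h.ne, add_zero]
      have := partialSum_add_le h0 h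
      have := t.2.1
      exact term_last hℓ φ j (by linarith)
    · subst h
      have : (s : ℝ) - partialSum ℓ j = t := by linarith
      rw [if_neg (lt_irrefl _), if_pos rfl, zero_add, this, Set.projIcc_val]
    · rw [if_neg h.asymm, if_neg h.ne', add_zero]
      have := partialSum_add_le h0 h
      have := t.2.2
      exact term_zero hℓ φ j (by linarith)
  rw [tensorFun, Finset.sum_congr rfl fun j _ => hterm j, Finset.sum_add_distrib,
    Finset.sum_ite_eq' Finset.univ i, if_pos (Finset.mem_univ i), partialSum,
    ← Finset.sum_filter]
  congr 1
  refine Finset.sum_congr ?_ fun _ _ => rfl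
  ext j; simp

end Reparam

/-- `γ : [0, L] → U` is the Moore composition `p₁ * ⋯ * pₙ` of the continuous maps
`pᵢ : [0, ℓᵢ] → U`: one has `L = ∑ ℓᵢ` and `γ(∑_{j < i} ℓ_j + t) = pᵢ(t)` for `t ∈ [0, ℓᵢ]`. For
nonnegative `ℓᵢ` this forces consecutive `pᵢ` to be composable, and it determines `γ` when
`n ≥ 1`. -/
def IsMooreComposition {U : Type*} [TopologicalSpace U] {n : ℕ} (ℓ : Fin n → ℝ)
    (p : ∀ i, C(Seg (ℓ i), U)) {L : ℝ} (γ : C(Seg L, U)) : Prop :=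
  ∑ i, ℓ i = L ∧
    ∀ (i : Fin n) (t : Seg (ℓ i)) (s : Seg L), (s : ℝ) = partialSum ℓ i + t → γ s = p i t

/-- A Moore path: a nonconstant continuous map `[0, ℓ] → U` with `ℓ > 0`. -/
structure MoorePath (U : Type*) [TopologicalSpace U] where
  length : ℝ
  length_pos : 0 < length
  toMap : C(Seg length, U)
  nonconstant : ∃ s t, toMap s ≠ toMap t

/-- `γ` is constant on `[a, b]`. -/
def MoorePath.ConstantOn {U : Type*} [TopologicalSpace U] (γ : MoorePath U)
    (a b : Seg γ.length) : Prop :=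
  ∀ s ∈ Set.Icc a b, ∀ t ∈ Set.Icc a b, γ.toMap s = γ.toMap t

/-- A stop interval `[a, b]`, `a < b`, of `γ`: a maximal interval on which `γ` is constant. -/
def MoorePath.IsStopInterval {U : Type*} [TopologicalSpace U] (γ : MoorePath U)
    (a b : Seg γ.length) : Prop :=
  a < b ∧ γ.ConstantOn a b ∧ ∀ a' b', a' ≤ a → b ≤ b' → γ.ConstantOn a' b' → a' = a ∧ b' = b

/-- A Moore path is regular if it has no stop interval. -/
def MoorePath.IsRegular {U : Type*} [TopologicalSpace U] (γ : MoorePath U) : Prop :=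
  ∀ a b, ¬ γ.IsStopInterval a b

/-- The normalized composition `γ₁ *_N γ₂` of two composable continuous paths. -/
noncomputable def normalizedComp {U : Type*} [TopologicalSpace U] (γ₁ γ₂ : C(unitInterval, U))
    (h : γ₁ 1 = γ₂ 0) : C(unitInterval, U) :=
  (Path.trans (⟨γ₁, rfl, h⟩ : Path (γ₁ 0) (γ₂ 0)) (⟨γ₂, rfl, rfl⟩ : Path (γ₂ 0) (γ₂ 1))).toContinuousMap

/-! ### The category of `𝒫`-multipointed `d`-spaces -/

/-- The two possible choices of the convenient category of topological spaces: all `Δ`-generated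
spaces, or the `Δ`-Hausdorff `Δ`-generated spaces. -/
inductive Convention
  | deltaGenerated
  | deltaHausdorff

/-- A space is `Δ`-Hausdorff if the image of every continuous map `[0, 1] → X` is closed. -/
def IsDeltaHausdorff (X : Type*) [TopologicalSpace X] : Prop :=
  ∀ f : C(unitInterval, X), IsClosed (Set.range f)

/-- `X` is an object of the chosen category of topological spaces. -/
def Convention.Admissible (c : Convention) (X : Type*) [TopologicalSpace X] : Prop :=
  match c with
  | .deltaGenerated => DeltaGeneratedSpace X
  | .deltaHausdorff => DeltaGeneratedSpace X ∧ IsDeltaHausdorff X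

theorem Convention.admissible_of_t2 (c : Convention) (X : Type*) [TopologicalSpace X]
    [DeltaGeneratedSpace X] [T2Space X] : c.Admissible X := by
  cases c
  · exact ‹DeltaGeneratedSpace X›
  · exact ⟨‹DeltaGeneratedSpace X›, fun f => (isCompact_range f.continuous).isClosed⟩

/-- A `𝒫`-multipointed `d`-space: an underlying space, a set of states and a set of execution
paths which start and end at states and which are stable under the reparametrizations of
`𝒫(1, 1)` and under normalized composition. -/
structure MDSpace (c : Convention) (P : Reparam) : Type (u + 1) where
  carrier : Type u
  [topology : TopologicalSpace carrier]
  admissible : c.Admissible carrier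
  states : Set carrier
  paths : Set C(unitInterval, carrier)
  source_mem : ∀ γ ∈ paths, γ 0 ∈ states
  target_mem : ∀ γ ∈ paths, γ 1 ∈ states
  reparam_mem : ∀ γ ∈ paths, ∀ φ : P.Hom 1 1, γ.comp φ.1 ∈ paths
  comp_mem : ∀ γ₁ ∈ paths, ∀ γ₂ ∈ paths, ∀ h : γ₁ 1 = γ₂ 0, normalizedComp γ₁ γ₂ h ∈ paths

attribute [instance] MDSpace.topology

namespace MDSpace

variable {c : Convention} {P : Reparam}

/-- A map of `𝒫`-multipointed `d`-spaces. -/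
@[ext]
structure Hom (X Y : MDSpace.{u} c P) where
  toMap : C(X.carrier, Y.carrier)
  map_states : ∀ x ∈ X.states, toMap x ∈ Y.states
  map_paths : ∀ γ ∈ X.paths, toMap.comp γ ∈ Y.paths

instance : Category (MDSpace.{u} c P) where
  Hom X Y := Hom X Y
  id X := ⟨ContinuousMap.id _, fun _ h => h, fun _ h => h⟩
  comp f g := ⟨g.toMap.comp f.toMap, fun _ h => g.map_states _ (f.map_states _ h),
    fun _ h => g.map_paths _ (f.map_paths _ h)⟩

/-- The `𝒫`-multipointed `d`-space is a set `E`, identified with the triple `(E, E, ∅)`. -/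
def IsDiscreteSet (X : MDSpace.{u} c P) : Prop :=
  DiscreteTopology X.carrier ∧ X.states = Set.univ ∧ X.paths = ∅

end MDSpace

/-! ### Topological globes -/

instance : DeltaGeneratedSpace Bool :=
  IsGeneratedBy.iff_le_generatedBy.2 (by rw [DiscreteTopology.eq_bot (α := Bool)]; exact bot_le)

/-- The identifications `(z, 0) = 0` and `(z, 1) = 1` on `{0, 1} ⊔ (Z × [0, 1])`, where the
product is taken in `Δ`-generated spaces. The points `0`, `1` of `{0, 1}` are `false`, `true`. -/
inductive GlobRel (Z : Type u) [TopologicalSpace Z] :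
    Bool ⊕ DeltaGeneratedSpace.of (Y := Z × unitInterval) →
    Bool ⊕ DeltaGeneratedSpace.of (Y := Z × unitInterval) → Prop
  | source (z : Z) : GlobRel Z (.inr (WithGeneratedByTopology.equiv.symm (z, 0))) (.inl false)
  | target (z : Z) : GlobRel Z (.inr (WithGeneratedByTopology.equiv.symm (z, 1))) (.inl true)

/-- The underlying space of the topological globe of `Z`. -/
abbrev GlobCarrier (Z : Type u) [TopologicalSpace Z] : Type u := Quot (GlobRel Z)

namespace GlobCarrier

variable {Z : Type u} [TopologicalSpace Z]

/-- The state `0` of the globe. -/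
def initial : GlobCarrier Z := Quot.mk _ (.inl false)

/-- The state `1` of the globe. -/
def final : GlobCarrier Z := Quot.mk _ (.inl true)

/-- The class of `(z, t)`. -/
def mk (z : Z) (t : unitInterval) : GlobCarrier Z :=
  Quot.mk _ (.inr (WithGeneratedByTopology.equiv.symm (z, t)))

theorem mk_zero (z : Z) : mk z 0 = initial := Quot.sound (.source z)

theorem mk_one (z : Z) : mk z 1 = final := Quot.sound (.target z)

theorem ind {p : GlobCarrier Z → Prop} (h0 : p initial) (h1 : p final)
    (h : ∀ z t, p (mk z t)) (x : GlobCarrier Z) : p x := by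
  induction x using Quot.ind with
  | mk a =>
    rcases a with (_ | _) | a
    · exact h0
    · exact h1
    · exact h (WithGeneratedByTopology.equiv a).1 (WithGeneratedByTopology.equiv a).2

/-- The path `δ_z : t ↦ (z, t)`. -/
def delta (z : Z) : C(unitInterval, GlobCarrier Z) where
  toFun t := mk z t
  continuous_toFun := by
    refine continuous_quot_mk.comp (continuous_inr.comp ?_)
    have : DeltaGeneratedSpace unitInterval := by
      have hq : IsQuotientMap (Set.projIcc (0 : ℝ) 1 zero_le_one) := isQuotientMap_projIcc
      have : DeltaGeneratedSpace ℝ :=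
        (Homeomorph.funUnique (Fin 1) ℝ).isQuotientMap.isGeneratedBy
      exact hq.isGeneratedBy
    exact (IsGeneratedBy.equiv_symm_comp_continuous_iff (X := fun n => Fin n → ℝ) (fun t : unitInterval => (z, t))).2
      (by fun_prop)

/-- The projection of the globe to `[0, 1]`. -/
def height : C(GlobCarrier Z, unitInterval) where
  toFun := Quot.lift (Sum.elim (fun b => if b then 1 else 0)
    fun a => (WithGeneratedByTopology.equiv a).2) (by rintro _ _ (z | z) <;> rfl)
  continuous_toFun := by
    refine continuous_quot_lift _ (Continuous.sumElim continuous_of_discreteTopology ?_)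
    exact continuous_snd.comp WithGeneratedByTopology.continuous_equiv

theorem height_mk (z : Z) (t : unitInterval) : height (mk z t) = t := rfl

theorem initial_ne_final : (initial : GlobCarrier Z) ≠ final := fun h =>
  zero_ne_one (α := unitInterval) (congrArg height h)

/-- The part of the globe lying over `U ⊆ Z`, without the states. -/
def tube (U : Set Z) : Set (GlobCarrier Z) :=
  {x | Quot.lift (Sum.elim (fun _ => False) fun a => (WithGeneratedByTopology.equiv a).1 ∈ U ∧
    (WithGeneratedByTopology.equiv a).2 ≠ 0 ∧ (WithGeneratedByTopology.equiv a).2 ≠ 1)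
    (by rintro _ _ (z | z) <;> simp) x}

theorem isOpen_tube {U : Set Z} (hU : IsOpen U) : IsOpen (tube U) := by
  rw [← isQuotientMap_quot_mk.isOpen_preimage, isOpen_sum_iff]
  refine ⟨isOpen_discrete _, ?_⟩
  exact (((hU.preimage continuous_fst).inter ((isClosed_singleton (x := 0)).isOpen_compl.inter
    (isClosed_singleton (x := 1)).isOpen_compl |>.preimage continuous_snd)).preimage
    WithGeneratedByTopology.continuous_equiv)

instance [T2Space Z] : T2Space (GlobCarrier Z) := by
  have key : ∀ x y : GlobCarrier Z, height x ≠ height y →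
      ∃ u v : Set (GlobCarrier Z), IsOpen u ∧ IsOpen v ∧ x ∈ u ∧ y ∈ v ∧ Disjoint u v := by
    intro x y h
    obtain ⟨u, v, hu, hv, hx, hy, hd⟩ := t2_separation h
    exact ⟨_, _, hu.preimage height.continuous, hv.preimage height.continuous, hx, hy,
      hd.preimage _⟩
  have h0 : ∀ x : GlobCarrier Z, height x = 0 → x = initial :=
    ind (fun _ => rfl) (fun h => absurd h (one_ne_zero (α := unitInterval)))
      fun z t h => by rw [height_mk] at h; rw [h, mk_zero]
  have h1 : ∀ x : GlobCarrier Z, height x = 1 → x = final :=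
    ind (fun h => absurd h (zero_ne_one (α := unitInterval))) (fun _ => rfl)
      fun z t h => by rw [height_mk] at h; rw [h, mk_one]
  have hm : ∀ x : GlobCarrier Z, height x ≠ 0 → height x ≠ 1 → ∃ z, x = mk z (height x) :=
    ind (fun h => absurd rfl h) (fun _ h => absurd rfl h) fun z t _ _ => ⟨z, rfl⟩
  refine ⟨fun x y hxy => ?_⟩
  by_cases h : height x = height y
  · have hx0 : height x ≠ 0 := fun hx => hxy ((h0 x hx).trans (h0 y (h ▸ hx)).symm)
    have hx1 : height x ≠ 1 := fun hx => hxy ((h1 x hx).trans (h1 y (h ▸ hx)).symm)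
    obtain ⟨z, hz⟩ := hm x hx0 hx1
    obtain ⟨z', hz'⟩ := hm y (h ▸ hx0) (h ▸ hx1)
    rw [← h] at hz'
    have hzz : z ≠ z' := fun e => hxy (by rw [hz, hz', e])
    obtain ⟨u, v, hu, hv, hzu, hzv, hd⟩ := t2_separation hzz
    refine ⟨tube u, tube v, isOpen_tube hu, isOpen_tube hv, ?_, ?_, ?_⟩
    · rw [hz]; exact ⟨hzu, hx0, hx1⟩
    · rw [hz']; exact ⟨hzv, hx0, hx1⟩
    · rw [Set.disjoint_left]
      exact ind (fun hf _ => hf) (fun hf _ => hf)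
        fun w t hw hw' => Set.disjoint_left.1 hd hw.1 hw'.1
  · exact key x y h

/-- The map of globes induced by a continuous map. -/
def map {Z' : Type u} [TopologicalSpace Z'] (f : C(Z, Z')) : C(GlobCarrier Z, GlobCarrier Z') where
  toFun := Quot.lift (Sum.elim (fun b => Quot.mk _ (.inl b))
    fun a => mk (f (WithGeneratedByTopology.equiv a).1) (WithGeneratedByTopology.equiv a).2) (by
      rintro _ _ (z | z)
      · exact mk_zero (f z)
      · exact mk_one (f z))
  continuous_toFun := by
    refine continuous_quot_lift _ (Continuous.sumElim continuous_of_discreteTopology ?_)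
    refine continuous_quot_mk.comp (continuous_inr.comp ?_)
    refine (IsGeneratedBy.equiv_symm_comp_continuous_iff (X := fun n => Fin n → ℝ)
      (fun a : DeltaGeneratedSpace.of (Y := Z × unitInterval) =>
        (f (WithGeneratedByTopology.equiv a).1, (WithGeneratedByTopology.equiv a).2))).2 ?_
    have := WithGeneratedByTopology.continuous_equiv (X := fun n => Fin n → ℝ)
      (Y := Z × unitInterval)
    fun_prop

end GlobCarrier

section Globes

variable (c : Convention) (P : Reparam)

/-- The topological globe `Glob^𝒫(Z)` of a (Hausdorff) space `Z`: its states are `0` and `1`, its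
execution paths are the `δ_z φ` with `z ∈ Z` and `φ ∈ 𝒫(1, 1)`. -/
def glob (Z : Type u) [TopologicalSpace Z] [T2Space Z] : MDSpace.{u} c P where
  carrier := GlobCarrier Z
  admissible := c.admissible_of_t2 _
  states := {GlobCarrier.initial, GlobCarrier.final}
  paths := {γ | ∃ (z : Z) (φ : P.Hom 1 1), γ = (GlobCarrier.delta z).comp φ.1}
  source_mem := by
    rintro _ ⟨z, φ, rfl⟩
    have h : φ.1 0 = 0 := Subtype.ext (φ.2.map_zero 0 le_rfl)
    exact Or.inl ((congrArg (GlobCarrier.mk z) h).trans (GlobCarrier.mk_zero z))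
  target_mem := by
    rintro _ ⟨z, φ, rfl⟩
    have h : φ.1 1 = 1 := Subtype.ext (φ.2.map_last 1 le_rfl)
    exact Or.inr ((congrArg (GlobCarrier.mk z) h).trans (GlobCarrier.mk_one z))
  reparam_mem := by
    rintro _ ⟨z, φ, rfl⟩ ψ
    exact ⟨z, φ.comp ψ, rfl⟩
  comp_mem := by
    rintro _ ⟨z, φ, rfl⟩ _ ⟨z', φ', rfl⟩ h
    have h1 : φ.1 1 = 1 := Subtype.ext (φ.2.map_last 1 le_rfl)
    have h0 : φ'.1 0 = 0 := Subtype.ext (φ'.2.map_zero 0 le_rfl)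
    exact absurd (((GlobCarrier.mk_zero z').symm.trans (congrArg (GlobCarrier.mk z') h0.symm)).trans
      (h.symm.trans ((congrArg (GlobCarrier.mk z) h1).trans (GlobCarrier.mk_one z))))
      GlobCarrier.initial_ne_final

/-- The map `Glob^𝒫(Z) → Glob^𝒫(Z')` induced by a continuous map `Z → Z'`. -/
def globMap {Z Z' : Type u} [TopologicalSpace Z] [T2Space Z] [TopologicalSpace Z'] [T2Space Z']
    (f : C(Z, Z')) : glob c P Z ⟶ glob c P Z' :=
  MDSpace.Hom.mk (X := glob c P Z) (Y := glob c P Z') (GlobCarrier.map f)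
    (by
      rintro _ (rfl | rfl)
      · exact Or.inl rfl
      · exact Or.inr rfl)
    (by
      rintro _ ⟨z, φ, rfl⟩
      exact ⟨f z, φ, rfl⟩)

/-- The disk `𝐃ⁿ` (`𝐃⁰` is a point), in an arbitrary universe. -/
abbrev Disk (n : ℕ) : Type u := ULift.{u} (Metric.closedBall (0 : EuclideanSpace ℝ (Fin n)) 1)

/-- The sphere `𝐒ⁿ⁻¹` of `ℝⁿ` (empty for `n = 0`), in an arbitrary universe. -/
abbrev Sphere (n : ℕ) : Type u := ULift.{u} (Metric.sphere (0 : EuclideanSpace ℝ (Fin n)) 1)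

/-- The inclusion `𝐒ⁿ⁻¹ ⊆ 𝐃ⁿ`. -/
def sphereIncl (n : ℕ) : C(Sphere.{u} n, Disk.{u} n) where
  toFun z := ⟨⟨z.down.1, Metric.sphere_subset_closedBall z.down.2⟩⟩
  continuous_toFun := by fun_prop

/-- The set `𝐃ⁿ \ 𝐒ⁿ⁻¹`. -/
abbrev InteriorDisk (n : ℕ) : Type u := {z : Disk.{u} n // z ∉ Set.range (sphereIncl n)}

/-! ### Cellular `𝒫`-multipointed `d`-spaces -/

/-- A transfinite tower `X₀ → X₁ → ⋯ → X_lam` of `𝒫`-multipointed `d`-spaces indexed by the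
ordinals `ν ≤ lam`, continuous at limit ordinals, starting at a set `X₀`, in which `X_{ν+1}` is
obtained from `X_ν` by attaching one globular cell along `g_ν : Glob^𝒫(𝐒^{n_ν - 1}) → X_ν`, for
every `ν < lam`. -/
structure CellularTower (lam : Ordinal.{w}) where
  functor : Set.Iic lam ⥤ MDSpace.{u} c P
  continuous : functor.IsWellOrderContinuous
  isDiscreteSet_zero : (functor.obj ⟨0, Set.mem_Iic.2 zero_le⟩).IsDiscreteSet
  /-- The integer `n_ν`. -/
  dim : Set.Iio lam → ℕ
  /-- The attaching map `g_ν`. -/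
  attach : ∀ ν : Set.Iio lam, glob c P (Sphere.{u} (dim ν)) ⟶ functor.obj ⟨ν.1, Set.mem_Iic.2 (le_of_lt ν.2)⟩
  /-- The map `ĝ_ν`, with values in `X_{ν+1}`. -/
  char : ∀ ν : Set.Iio lam, glob c P (Disk.{u} (dim ν)) ⟶
    functor.obj ⟨Order.succ ν.1, Set.mem_Iic.2 (Order.succ_le_of_lt ν.2)⟩
  isPushout : ∀ ν : Set.Iio lam, IsPushout (attach ν) (globMap c P (sphereIncl (dim ν)))
    (functor.map (homOfLE (Subtype.mk_le_mk.2 (Order.le_succ ν.1)))) (char ν)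

namespace CellularTower

variable {c P} {lam : Ordinal.{w}} (X : CellularTower.{w, u} c P lam)

/-- The cellular `𝒫`-multipointed `d`-space `X_lam`. -/
def total : MDSpace.{u} c P := X.functor.obj ⟨lam, Set.mem_Iic.2 le_rfl⟩

/-- The map `ĝ_ν : Glob^𝒫(𝐃^{n_ν}) → X_lam`. -/
def cellMap (ν : Set.Iio lam) : glob c P (Disk.{u} (X.dim ν)) ⟶ X.total :=
  X.char ν ≫ X.functor.map (homOfLE (Subtype.mk_le_mk.2 (Order.succ_le_of_lt ν.2)))

/-- The path `ĝ_ν δ_z` of `X_lam` for `z ∈ 𝐃^{n_ν}`. -/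
def cellPath (ν : Set.Iio lam) (z : Disk.{u} (X.dim ν)) : C(Seg 1, X.total.carrier) :=
  (MDSpace.Hom.toMap (X.cellMap ν)).comp (GlobCarrier.delta z)

/-- The Moore decompositions of `γ` into `n ≥ 1` pieces
`γ = (ĝ_{ν₁} δ_{z₁} φ₁ μ_{ℓ₁}) * ⋯ * (ĝ_{νₙ} δ_{zₙ} φₙ μ_{ℓₙ})`. -/
structure Decomposition (γ : C(unitInterval, X.total.carrier)) (n : ℕ) where
  one_le : 1 ≤ n
  /-- The pairs `(νᵢ, zᵢ)` with `νᵢ < lam` and `zᵢ ∈ 𝐃^{n_{νᵢ}} \ 𝐒^{n_{νᵢ} - 1}`. -/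
  cell : Fin n → Σ ν : Set.Iio lam, InteriorDisk.{u} (X.dim ν)
  φ : Fin n → P.Hom 1 1
  ℓ : Fin n → ℝ
  ℓ_pos : ∀ i, 0 < ℓ i
  sum_ℓ : ∑ i, ℓ i = 1
  isMooreComposition : IsMooreComposition ℓ
    (fun i => (X.cellPath (cell i).1 (cell i).2.1).comp ((φ i).comp (P.mu (ℓ i) (ℓ_pos i))).1) γ

/-- The tensor product `(φ₁ μ_{ℓ₁}) ⊗ ⋯ ⊗ (φₙ μ_{ℓₙ}) ∈ 𝒫(1, n)` of a decomposition. -/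
noncomputable def Decomposition.tensor {X : CellularTower.{w, u} c P lam}
    {γ : C(unitInterval, X.total.carrier)} {n : ℕ} (d : X.Decomposition γ n) : P.Hom 1 n :=
  Reparam.tensor (ℓ' := fun _ => 1) d.ℓ_pos (fun i => (d.φ i).comp (P.mu (d.ℓ i) (d.ℓ_pos i)))
    d.sum_ℓ (by simp)

/-- `N` is the Moore composition `(ĝ_{ν₁} δ_{z₁}) * ⋯ * (ĝ_{νₙ} δ_{zₙ})` for some decomposition of
`γ`. -/
def IsNaturalization (γ : C(unitInterval, X.total.carrier)) (N : MoorePath X.total.carrier) :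
    Prop :=
  ∃ (n : ℕ) (d : X.Decomposition γ n),
    IsMooreComposition (fun _ => 1) (fun i => X.cellPath (d.cell i).1 (d.cell i).2.1) N.toMap

/-- `l` is the sequence of cells `[c_{ν₁}, …, c_{νₙ}]` (given by their indices) of some
decomposition of `γ`. -/
def IsCarrier (γ : C(unitInterval, X.total.carrier)) (l : List (Set.Iio lam)) : Prop :=
  ∃ (n : ℕ) (d : X.Decomposition γ n), l = List.ofFn fun i => (d.cell i).1

end CellularTower

end Globes

/-! ### `Δ`-generated spaces -/

/-! Write `p k` for the path `ĝ_ν δ_z`, where `k = (ν, z)` and `z` is an interior point of the disk.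
A natural form of `γ` is a factorization `γ = F ∘ ψ` with `ψ ∈ 𝒫(1, n)` and `F` the Moore
composition of `n` paths `p k` on `[0, n]`. Decompositions of `γ` and natural forms of `γ` determine
each other: the tensor product of a decomposition is the map `ψ`, and cutting `[0, 1]` at times
where `ψ` takes the values `0, …, n` recovers a decomposition.

Existence. Paths with a natural form are stable under reparametrization and normalized composition,
and by the universal property the execution paths of a pushout or colimit are generated under these
operations by those of the legs (`MapsInto.of_isPushout`, `MapsInto.of_isColimit`). Transfinite
induction then applies (`mapsInto_toTotal`): a path `δ_z φ` of a new globe is a natural form of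
length one if `z` is interior, and comes from the previous stage otherwise.

Uniqueness. Interior points of the paths `p k` determine both `k` and the parameter
(`separatesInterior`). If `F ∘ ψ = F' ∘ ψ'`, then `ψ - ψ'` takes integer values; being continuous
and zero at `0`, it vanishes. Its value at `1` gives `n = n'`, and the midpoints of the unit
segments give the cells. The same separation prevents `F` from being constant on a nontrivial
interval, hence regularity.

Separation is obtained without describing the underlying spaces of the colimits, so uniformly in
both conventions. By Tietze, globes of sphere inclusions lift against `ℝ → pt`; so do pushouts and
transfinite compositions of them. Thus bump functions supported in one open cell extend to `X_lam`
(`exists_bump`) and distinguish its points. -/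

/-- A space which is locally a retract of `X`-generated spaces is `X`-generated. -/
theorem Topology.IsGeneratedBy.of_local_retract {ι : Type*} {X : ι → Type*}
    [∀ i, TopologicalSpace (X i)] {Y Z : Type*} [TopologicalSpace Y] [TopologicalSpace Z]
    [IsGeneratedBy X Y]
    (h : ∀ z : Z, ∃ (r : C(Y, Z)) (s : Z → Y), ContinuousAt s z ∧ ∀ᶠ x in 𝓝 z, r (s x) = x) :
    IsGeneratedBy X Z where
  continuous_equiv_symm := by
    refine continuous_iff_continuousAt.2 fun z => ?_
    obtain ⟨r, s, hs, hrs⟩ := h z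
    have h1 : Continuous (WithGeneratedByTopology.equiv (X := X).symm ∘ r) :=
      (IsGeneratedBy.equiv_symm_comp_continuous_iff X r).2 r.continuous
    refine (h1.continuousAt.comp hs).congr ?_
    filter_upwards [hrs] with x hx
    simp [hx]

section Radial

variable {E : Type*} [NormedAddCommGroup E] [NormedSpace ℝ E]

/-- The radial retraction of a normed space onto the closed ball of radius `r` around `a`. -/
noncomputable def ballRetraction (a : E) (r : ℝ) (x : E) : E :=
  a + (r / max r ‖x - a‖) • (x - a)

theorem continuous_ballRetraction (a : E) {r : ℝ} (hr : 0 < r) :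
    Continuous (ballRetraction a r) := by
  unfold ballRetraction
  refine continuous_const.add (Continuous.smul ?_ (by fun_prop))
  exact continuous_const.div (by fun_prop) fun x => (lt_max_of_lt_left hr).ne'

theorem ballRetraction_mem (a : E) {r : ℝ} (hr : 0 < r) (x : E) :
    ballRetraction a r x ∈ Metric.closedBall a r := by
  have h : 0 < max r ‖x - a‖ := lt_max_of_lt_left hr
  rw [mem_closedBall_iff_norm, ballRetraction, add_sub_cancel_left, norm_smul, Real.norm_eq_abs,
    abs_of_pos (div_pos hr h), div_mul_eq_mul_div, div_le_iff₀ h]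
  exact mul_le_mul_of_nonneg_left (le_max_right _ _) hr.le

theorem ballRetraction_of_mem {a : E} {r : ℝ} (hr : 0 < r) {x : E}
    (hx : x ∈ Metric.closedBall a r) : ballRetraction a r x = x := by
  rw [mem_closedBall_iff_norm] at hx
  rw [ballRetraction, max_eq_left hx, div_self hr.ne', one_smul, add_sub_cancel]

end Radial

/-- This is the model `ℝⁿ × ℝ ≅ ℝⁿ⁺¹` of which the cylinders on disks and spheres are (local)
retracts. -/
instance deltaGeneratedSpace_euclidean_prod (n : ℕ) :
    DeltaGeneratedSpace (EuclideanSpace ℝ (Fin n) × ℝ) := by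
  let e : (Fin (n + 1) → ℝ) ≃ₜ EuclideanSpace ℝ (Fin n) × ℝ :=
    ((Fin.consEquivL ℝ fun _ : Fin (n + 1) => ℝ).symm.toHomeomorph.trans
      (Homeomorph.prodComm _ _)).trans
      (Homeomorph.prodCongr (EuclideanSpace.equiv (Fin n) ℝ).symm.toHomeomorph (Homeomorph.refl ℝ))
  exact e.isQuotientMap.isGeneratedBy

instance deltaGeneratedSpace_disk_prod (n : ℕ) :
    DeltaGeneratedSpace (Disk.{u} n × unitInterval) := by
  refine IsGeneratedBy.of_local_retract (Y := EuclideanSpace ℝ (Fin n) × ℝ) fun p =>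
    ⟨⟨fun q => (⟨⟨ballRetraction 0 1 q.1, ballRetraction_mem 0 one_pos _⟩⟩,
      Set.projIcc 0 1 zero_le_one q.2), ?_⟩, fun q => (q.1.down.1, q.2.1), ?_, ?_⟩
  · have := continuous_ballRetraction (0 : EuclideanSpace ℝ (Fin n)) one_pos
    exact (continuous_uliftUp.comp ((this.comp continuous_fst).subtype_mk _)).prodMk
      (continuous_projIcc.comp continuous_snd)
  · fun_prop
  · refine Filter.Eventually.of_forall fun q => Prod.ext (ULift.ext _ _ (Subtype.ext ?_)) ?_
    · exact ballRetraction_of_mem one_pos q.1.down.2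
    · exact Set.projIcc_val zero_le_one q.2

/-- A sphere is only locally a retract of `ℝⁿ`: near `a`, retract onto a small ball around `a`, then
normalize. -/
instance deltaGeneratedSpace_sphere_prod (n : ℕ) :
    DeltaGeneratedSpace (Sphere.{u} n × unitInterval) := by
  refine IsGeneratedBy.of_local_retract (Y := EuclideanSpace ℝ (Fin n) × ℝ) fun p => ?_
  set a : EuclideanSpace ℝ (Fin n) := p.1.down.1 with ha
  have ha1 : ‖a‖ = 1 := mem_sphere_zero_iff_norm.1 p.1.down.2
  let r : EuclideanSpace ℝ (Fin n) → EuclideanSpace ℝ (Fin n) := ballRetraction a 2⁻¹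
  have hr : Continuous r := continuous_ballRetraction a (by norm_num)
  -- The radius `1/2` is less than `‖a‖ = 1`, so the ball avoids the origin and the normalization is
  -- continuous.
  have hr0 : ∀ x, ‖r x‖ ≠ 0 := fun x h => by
    have h1 := ballRetraction_mem a (r := 2⁻¹) (by norm_num) x
    change r x ∈ _ at h1
    rw [norm_eq_zero.1 h, mem_closedBall_iff_norm', sub_zero, ha1] at h1
    norm_num at h1
  refine ⟨⟨fun q => (⟨⟨‖r q.1‖⁻¹ • r q.1, ?_⟩⟩, Set.projIcc 0 1 zero_le_one q.2), ?_⟩,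
    fun q => (q.1.down.1, q.2.1), ?_, ?_⟩
  · rw [mem_sphere_zero_iff_norm, norm_smul, norm_inv, norm_norm, inv_mul_cancel₀ (hr0 _)]
  · have h2 : Continuous fun x => ‖r x‖⁻¹ • r x := (hr.norm.inv₀ hr0).smul hr
    exact (continuous_uliftUp.comp ((h2.comp continuous_fst).subtype_mk _)).prodMk
      (continuous_projIcc.comp continuous_snd)
  · fun_prop
  · have h3 : ContinuousAt (fun q : Sphere.{u} n × unitInterval => q.1.down.1) p := by fun_prop
    filter_upwards [h3 (Metric.closedBall_mem_nhds a (by norm_num : (0 : ℝ) < 2⁻¹))] with q hq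
    refine Prod.ext (ULift.ext _ _ (Subtype.ext ?_)) (Set.projIcc_val zero_le_one q.2)
    have h4 : r q.1.down.1 = q.1.down.1 := ballRetraction_of_mem (by norm_num) hq
    change ‖r q.1.down.1‖⁻¹ • r q.1.down.1 = q.1.down.1
    rw [h4, mem_sphere_zero_iff_norm.1 q.1.down.2, inv_one, one_smul]

/-- The real line is needed as an object of the category, as the target of the bump functions. -/
instance deltaGeneratedSpace_ulift_real : DeltaGeneratedSpace (ULift.{u} ℝ) :=
  ((Homeomorph.funUnique (Fin 1) ℝ).trans Homeomorph.ulift.symm).isQuotientMap.isGeneratedBy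

/-! ### The underlying spaces of globes -/

namespace GlobCarrier

variable {Z : Type u} [TopologicalSpace Z]

/-- When `Z × [0, 1]` is already `Δ`-generated, its `Δ`-generated topology is the product topology,
so the globe is a quotient of a compact space. -/
theorem compactSpace [CompactSpace Z] [DeltaGeneratedSpace (Z × unitInterval)] :
    CompactSpace (GlobCarrier Z) := by
  have : CompactSpace (DeltaGeneratedSpace.of (Y := Z × unitInterval)) :=
    (IsGeneratedBy.homeomorph (X := fun n => Fin n → ℝ) (Y := Z × unitInterval)).symm.compactSpace
  exact Quot.compactSpace

/-- Membership in `tube {z}` is well defined on the quotient and reads off the first coordinate;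
`height` reads off the second. -/
theorem mk_eq_mk {z z' : Z} {t t' : unitInterval} (h0 : t ≠ 0) (h1 : t ≠ 1)
    (h : mk z t = mk z' t') : z = z' ∧ t = t' := by
  have h2 : mk z' t' ∈ tube {z} := h ▸ ⟨rfl, h0, h1⟩
  exact ⟨h2.1.symm, congrArg height h⟩

theorem eq_initial_or_final_or_mk (x : GlobCarrier Z) :
    x = initial ∨ x = final ∨ ∃ z t, t ≠ 0 ∧ t ≠ 1 ∧ x = mk z t := by
  revert x
  refine ind (.inl rfl) (.inr (.inl rfl)) fun z t => ?_
  by_cases h0 : t = 0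
  · exact .inl (h0 ▸ mk_zero z)
  by_cases h1 : t = 1
  · exact .inr (.inl (h1 ▸ mk_one z))
  exact .inr (.inr ⟨z, t, h0, h1, rfl⟩)

theorem height_map {Z' : Type u} [TopologicalSpace Z'] (f : C(Z, Z')) (x : GlobCarrier Z) :
    height (map f x) = height x := by
  revert x
  exact ind rfl rfl fun _ _ => rfl

theorem map_injective {Z' : Type u} [TopologicalSpace Z'] {f : C(Z, Z')}
    (hf : Function.Injective f) : Function.Injective (map f) := by
  intro x y h
  have hh : height x = height y := by rw [← height_map f, h, height_map]
  rcases eq_initial_or_final_or_mk x with rfl | rfl | ⟨z, t, h0, h1, rfl⟩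
  · rcases eq_initial_or_final_or_mk y with rfl | rfl | ⟨z, t, h0, h1, rfl⟩
    · rfl
    · exact absurd hh (zero_ne_one (α := unitInterval))
    · exact absurd hh.symm h0
  · rcases eq_initial_or_final_or_mk y with rfl | rfl | ⟨z, t, h0, h1, rfl⟩
    · exact absurd hh.symm (zero_ne_one (α := unitInterval))
    · rfl
    · exact absurd hh.symm h1
  · rcases eq_initial_or_final_or_mk y with rfl | rfl | ⟨z', t', h0', h1', rfl⟩
    · exact absurd hh h0
    · exact absurd hh h1
    · obtain ⟨h2, h3⟩ : f z = f z' ∧ t = t' := mk_eq_mk h0 h1 h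
      rw [hf h2, h3]

theorem mk_mem_range_map {Z' : Type u} [TopologicalSpace Z'] {f : C(Z, Z')} {z : Z'}
    {t : unitInterval} (h0 : t ≠ 0) (h1 : t ≠ 1) (h : mk z t ∈ Set.range (map f)) :
    z ∈ Set.range f := by
  obtain ⟨x, hx⟩ := h
  have hh : height x = t := by rw [← height_map f, hx]; rfl
  rcases eq_initial_or_final_or_mk x with rfl | rfl | ⟨z', t', h0', h1', rfl⟩
  · exact absurd hh.symm h0
  · exact absurd hh.symm h1
  · exact ⟨z', (mk_eq_mk h0 h1 hx.symm).1.symm⟩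

end GlobCarrier

instance compactSpace_glob_disk (n : ℕ) : CompactSpace (GlobCarrier (Disk.{u} n)) :=
  GlobCarrier.compactSpace

instance compactSpace_glob_sphere (n : ℕ) : CompactSpace (GlobCarrier (Sphere.{u} n)) :=
  GlobCarrier.compactSpace

theorem sphereIncl_injective (n : ℕ) : Function.Injective (sphereIncl.{u} n) := fun _ _ h =>
  ULift.ext _ _ (Subtype.ext (congrArg (fun z : Disk.{u} n => z.down.1) h))

/-- An injective continuous map from a compact space to a Hausdorff space. Closedness is what Tietze
and Urysohn require below. -/
theorem isClosedEmbedding_map_sphereIncl (n : ℕ) :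
    IsClosedEmbedding (GlobCarrier.map (sphereIncl.{u} n)) :=
  (GlobCarrier.map (sphereIncl.{u} n)).continuous.isClosedEmbedding
    (GlobCarrier.map_injective (sphereIncl_injective n))

/-! ### Reparametrizations and Moore compositions -/

theorem partialSum_one {n : ℕ} (i : Fin n) : partialSum (fun _ : Fin n => (1 : ℝ)) i = i := by
  simp [partialSum]

theorem partialSum_zero {n : ℕ} (ℓ : Fin n → ℝ) (h : 0 < n) : partialSum ℓ ⟨0, h⟩ = 0 := by
  refine Finset.sum_eq_zero fun j hj => ?_
  simp [Fin.lt_def] at hj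

theorem partialSum_succ {n : ℕ} (ℓ : Fin n → ℝ) {i : ℕ} (h : i + 1 < n) :
    partialSum ℓ ⟨i + 1, h⟩
      = partialSum ℓ ⟨i, (Nat.lt_succ_self i).trans h⟩ + ℓ ⟨i, (Nat.lt_succ_self i).trans h⟩ := by
  rw [partialSum_add, partialSum]
  congr 1
  ext j
  simp [Fin.lt_def, Fin.le_def]

theorem partialSum_sub {n : ℕ} (t : ℕ → ℝ) (i : Fin n) :
    partialSum (fun j : Fin n => t (j + 1) - t j) i = t i - t 0 := by
  obtain ⟨i, hi⟩ := i
  induction i with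
  | zero => simp [partialSum_zero]
  | succ i ih => rw [partialSum_succ, ih]; simp

/-- Every point of `[0, ∑ ℓᵢ]` lies in one of the segments of length `ℓᵢ`. -/
theorem exists_eq_partialSum_add {n : ℕ} {ℓ : Fin n → ℝ} (hn : 0 < n) (hℓ : ∀ i, 0 ≤ ℓ i) {s : ℝ}
    (h0 : 0 ≤ s) (h1 : s ≤ ∑ j, ℓ j) : ∃ (i : Fin n) (t : Seg (ℓ i)), s = partialSum ℓ i + t := by
  rcases h1.lt_or_eq with h | h
  · obtain ⟨i, hi1, hi2⟩ := exists_partialSum_le_lt s h0 h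
    exact ⟨i, ⟨s - partialSum ℓ i, by linarith, by linarith⟩, by simp⟩
  · refine ⟨⟨n - 1, by omega⟩, ⟨ℓ _, hℓ _, le_rfl⟩, ?_⟩
    rw [h, partialSum_add]
    refine (Finset.sum_congr ?_ fun _ _ => rfl)
    ext j
    simp only [Finset.mem_univ, Finset.mem_Iic, true_iff, Fin.le_def]
    omega

/-- Every point of `[0, n]` is of the form `i + t` with `i < n` and `t ∈ [0, 1]`. -/
theorem exists_eq_natCast_add {n : ℕ} (hn : 1 ≤ n) {x : ℝ} (h0 : 0 ≤ x) (h1 : x ≤ n) :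
    ∃ i < n, ∃ t : Seg 1, x = i + t := by
  obtain ⟨i, t, h⟩ := exists_eq_partialSum_add (ℓ := fun _ : Fin n => (1 : ℝ)) hn
    (fun _ => zero_le_one) h0 (by simpa using h1)
  exact ⟨i, i.2, t, by rw [h, partialSum_one]⟩

namespace Reparam

variable {P : Reparam}

theorem Hom.map_zero {L : ℝ} (ψ : P.Hom 1 L) : (ψ.1 0 : ℝ) = 0 := ψ.2.map_zero 0 le_rfl

theorem Hom.map_one {L : ℝ} (ψ : P.Hom 1 L) : (ψ.1 1 : ℝ) = L := ψ.2.map_last 1 le_rfl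

/-- The normalized composition of two reparametrizations. -/
theorem exists_concat {L₁ L₂ : ℝ} (ψ₁ : P.Hom 1 L₁) (ψ₂ : P.Hom 1 L₂) :
    ∃ ψ : P.Hom 1 (L₁ + L₂),
      (∀ s t : Seg 1, (t : ℝ) = 2 * s → (ψ.1 s : ℝ) = ψ₁.1 t) ∧
      ∀ s t : Seg 1, (t : ℝ) = 2 * s - 1 → (ψ.1 s : ℝ) = L₁ + ψ₂.1 t := by
  have half_pos : (0 : ℝ) < 1 / 2 := by norm_num
  let φ : ∀ i : Fin 2, P.Hom ((fun _ => 1 / 2) i) (![L₁, L₂] i) :=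
    Fin.cons (ψ₁.comp (P.mu (1 / 2) half_pos))
      (Fin.cons (ψ₂.comp (P.mu (1 / 2) half_pos)) fun i => i.elim0)
  have hL : ∑ _ : Fin 2, (1 / 2 : ℝ) = 1 := by norm_num
  have hL' : ∑ i, ![L₁, L₂] i = L₁ + L₂ := by simp
  refine ⟨tensor (fun _ => half_pos) φ hL hL', fun s t h => ?_, fun s t h => ?_⟩
  · have h1 := t.2.1
    have h2 := t.2.2
    rw [tensor_apply (fun _ => half_pos) φ hL hL' 0 ⟨s, by linarith, by linarith⟩ s
      (by simp [partialSum])]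
    have h3 : (P.mu (1 / 2) half_pos).1 ⟨s, by linarith, by linarith⟩ = t :=
      Subtype.ext (by change (s : ℝ) / (1 / 2) = t; rw [h]; ring)
    change _ + (ψ₁.1 ((P.mu (1 / 2) half_pos).1 ⟨s, _⟩) : ℝ) = _
    rw [h3]
    exact (congrArg (· + _) (partialSum_zero ![L₁, L₂] two_pos)).trans (zero_add _)
  · have h1 := t.2.1
    have h2 := t.2.2
    rw [tensor_apply (fun _ => half_pos) φ hL hL' 1 ⟨s - 1 / 2, by linarith, by linarith⟩ s
      (by rw [show (1 : Fin 2) = ⟨0 + 1, by norm_num⟩ from rfl, partialSum_succ, partialSum_zero]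
          simp)]
    have h3 : (P.mu (1 / 2) half_pos).1 ⟨s - 1 / 2, by linarith, by linarith⟩ = t :=
      Subtype.ext (by change ((s : ℝ) - 1 / 2) / (1 / 2) = t; rw [h]; ring)
    change _ + (ψ₂.1 ((P.mu (1 / 2) half_pos).1 ⟨s - 1 / 2, _⟩) : ℝ) = _
    rw [h3, show (1 : Fin 2) = ⟨0 + 1, by norm_num⟩ from rfl, partialSum_succ, partialSum_zero]
    simp

/-- The restriction of a reparametrization to a segment on which it increases by `1`, normalized to
`[0, 1]`. -/
theorem exists_restrict {L : ℝ} (ψ : P.Hom 1 L) {a b : Seg 1} {m : ℝ} (hab : a ≤ b)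
    (ha : (ψ.1 a : ℝ) = m) (hb : (ψ.1 b : ℝ) = m + 1) :
    ∃ φ : P.Hom 1 1, ∀ s t : Seg 1, (s : ℝ) = a + t * (b - a) → (ψ.1 s : ℝ) = m + φ.1 t := by
  have hab' : (a : ℝ) ≤ b := hab
  have hne : (a : ℝ) ≠ b := fun h => by
    rw [Subtype.ext h, hb] at ha
    linarith
  have hlt : 0 < (b : ℝ) - a := sub_pos.2 (lt_of_le_of_ne hab' hne)
  let i : Seg 1 → Seg 1 := fun t => ⟨a + t * (b - a),
    add_nonneg a.2.1 (mul_nonneg t.2.1 hlt.le), by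
      have := mul_le_of_le_one_left hlt.le t.2.2
      linarith [b.2.2]⟩
  have hi : Continuous i := by fun_prop
  have hi_mono : StrictMono i := fun s t h => by
    have h' : (s : ℝ) < t := h
    exact Subtype.coe_lt_coe.1 (add_lt_add_right (mul_lt_mul_of_pos_right h' hlt) _)
  have hi0 : i 0 = a := Subtype.ext (by simp [i])
  have hi1 : i 1 = b := Subtype.ext (by simp [i])
  let φ : C(Seg 1, Seg 1) := ⟨fun t => ⟨(ψ.1 (i t) : ℝ) - m, by
      have h : ψ.1 (i 0) ≤ ψ.1 (i t) := ψ.2.monotone (hi_mono.monotone t.2.1)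
      have h' : (ψ.1 (i 0) : ℝ) ≤ ψ.1 (i t) := h
      rw [hi0, ha] at h'
      linarith, by
      have h : ψ.1 (i t) ≤ ψ.1 (i 1) := ψ.2.monotone (hi_mono.monotone t.2.2)
      have h' : (ψ.1 (i t) : ℝ) ≤ ψ.1 (i 1) := h
      rw [hi1, hb] at h'
      linarith⟩, by
    have := ψ.1.continuous
    fun_prop⟩
  have hmono : Monotone φ := fun s t h =>
    Subtype.coe_le_coe.1 (sub_le_sub_right (Subtype.coe_le_coe.2
      (ψ.2.monotone (hi_mono.monotone h))) m)
  have hφ0 : φ 0 = 0 := Subtype.ext (by change (ψ.1 (i 0) : ℝ) - m = 0; rw [hi0, ha, sub_self])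
  have hφ1 : φ 1 = 1 := Subtype.ext (by change (ψ.1 (i 1) : ℝ) - m = 1; rw [hi1, hb]; ring)
  have hsurj : Function.Surjective φ := fun y => by
    have h := intermediate_value_univ (0 : Seg 1) 1 φ.continuous
    rw [hφ0, hφ1] at h
    exact h ⟨y.2.1, y.2.2⟩
  refine ⟨⟨φ, ?_⟩, fun s t h => ?_⟩
  · cases P with
    | M => exact ⟨hmono, hsurj⟩
    | G =>
      refine isReparam_of_bijective hmono ⟨fun s t h => ?_, hsurj⟩
      have h' : (ψ.1 (i s) : ℝ) - m = ψ.1 (i t) - m := congrArg Subtype.val h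
      exact hi_mono.injective (ψ.2.2.injective (Subtype.ext (by linarith)))
  · rw [show s = i t from Subtype.ext h]
    change _ = m + ((ψ.1 (i t) : ℝ) - m)
    ring

end Reparam

/-! ### Natural forms of paths -/

section NaturalForm

variable {P : Reparam} {U κ : Type*} [TopologicalSpace U]

/-- The path `γ` is the reparametrization by `ψ ∈ 𝒫(1, n)` of the Moore composition `F` of the paths
`p (c 0), …, p (c (n - 1))`. -/
structure IsNaturalForm (p : κ → C(unitInterval, U)) (γ : C(unitInterval, U)) (n : ℕ) (c : ℕ → κ)
    (F : ℝ → U) {L : ℝ} (ψ : P.Hom 1 L) : Prop where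
  -- Keeping `L` apart from the cast of `n` lets the length of a composite be `n₁ + n₂` in `ℝ`
  -- without transporting `ψ`.
  length_eq : L = n
  one_le : 1 ≤ n
  apply_add : ∀ i < n, ∀ t : unitInterval, F (i + t) = p (c i) t
  factor : ∀ s, γ s = F (ψ.1 s)

variable (P) in
/-- The path `γ` has a natural form. -/
def HasNaturalForm (p : κ → C(unitInterval, U)) (γ : C(unitInterval, U)) : Prop :=
  ∃ (n : ℕ) (c : ℕ → κ) (F : ℝ → U) (L : ℝ) (ψ : P.Hom 1 L), IsNaturalForm p γ n c F ψ

variable {p : κ → C(unitInterval, U)}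

/-- The base case, of length one. Clamping only makes `F` total: its values outside `[0, 1]` play no
role. -/
theorem hasNaturalForm_comp_hom (k : κ) (φ : P.Hom 1 1) : HasNaturalForm P p ((p k).comp φ.1) :=
  ⟨1, fun _ => k, fun x => p k (Set.projIcc 0 1 zero_le_one x), 1, φ, by simp, le_rfl,
    fun i hi t => by
      rw [Nat.lt_one_iff.1 hi, Nat.cast_zero, zero_add, Set.projIcc_val],
    fun s => by rw [Set.projIcc_val]; rfl⟩

theorem HasNaturalForm.reparam {γ : C(unitInterval, U)} (h : HasNaturalForm P p γ)
    (φ : P.Hom 1 1) : HasNaturalForm P p (γ.comp φ.1) := by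
  obtain ⟨n, c, F, L, ψ, h⟩ := h
  exact ⟨n, c, F, L, ψ.comp φ, h.length_eq, h.one_le, h.apply_add, fun s => h.factor (φ.1 s)⟩

theorem IsNaturalForm.apply_natCast {γ : C(unitInterval, U)} {n : ℕ} {c : ℕ → κ} {F : ℝ → U}
    {L : ℝ} {ψ : P.Hom 1 L} (h : IsNaturalForm p γ n c F ψ) : F n = γ 1 := by
  rw [h.factor, ψ.map_one, h.length_eq]

theorem HasNaturalForm.normalizedComp {γ₁ γ₂ : C(unitInterval, U)} (h₁ : HasNaturalForm P p γ₁)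
    (h₂ : HasNaturalForm P p γ₂) (h : γ₁ 1 = γ₂ 0) :
    HasNaturalForm P p (normalizedComp γ₁ γ₂ h) := by
  obtain ⟨n₁, c₁, F₁, L₁, ψ₁, h₁⟩ := h₁
  obtain ⟨n₂, c₂, F₂, L₂, ψ₂, h₂⟩ := h₂
  obtain rfl := h₁.length_eq
  obtain rfl := h₂.length_eq
  obtain ⟨ψ, hψ₁, hψ₂⟩ := Reparam.exists_concat ψ₁ ψ₂
  let F : ℝ → U := fun x => if x ≤ n₁ then F₁ x else F₂ (x - n₁)
  have hF₁ : ∀ x : ℝ, x ≤ n₁ → F x = F₁ x := fun x hx => if_pos hx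
  have hF₂ : ∀ x : ℝ, 0 ≤ x → F (n₁ + x) = F₂ x := fun x hx => by
    rcases hx.eq_or_lt with rfl | hx
    · rw [add_zero, hF₁ _ le_rfl, h₁.apply_natCast, h, h₂.factor, ψ₂.map_zero]
    · change ite _ _ _ = _
      rw [if_neg (by linarith), add_sub_cancel_left]
  refine ⟨n₁ + n₂, fun i => if i < n₁ then c₁ i else c₂ (i - n₁), F, _, ψ, by push_cast; rfl,
    le_add_right h₁.one_le, fun i hi t => ?_, fun s => ?_⟩
  · by_cases hin : i < n₁
    · have h3 : ((i + 1 : ℕ) : ℝ) ≤ n₁ := Nat.cast_le.2 hin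
      push_cast at h3
      rw [if_pos hin, hF₁ _ (by linarith [t.2.2]), h₁.apply_add i hin]
    · obtain ⟨j, rfl⟩ := Nat.exists_eq_add_of_le (not_lt.1 hin)
      have h3 : (0 : ℝ) ≤ j := Nat.cast_nonneg j
      rw [if_neg hin, Nat.add_sub_cancel_left, Nat.cast_add, add_assoc,
        hF₂ _ (add_nonneg h3 t.2.1), h₂.apply_add j (by omega)]
  · have h0 := s.2.1
    have h1 := s.2.2
    change (Path.trans _ _) s = _
    rw [Path.trans_apply]
    split_ifs with hs
    · rw [hψ₁ s ⟨2 * s, by linarith, by linarith⟩ rfl, hF₁ _ (Subtype.prop (ψ₁.1 _)).2]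
      exact h₁.factor _
    · rw [hψ₂ s ⟨2 * s - 1, by linarith, by linarith⟩ rfl, hF₂ _ (Subtype.prop (ψ₂.1 _)).1]
      exact h₂.factor _

/-- The points of the paths `p k`, apart from their endpoints, are determined by `k` and the
parameter. -/
def SeparatesInterior (p : κ → C(unitInterval, U)) : Prop :=
  ∀ ⦃k k' : κ⦄ ⦃s s' : unitInterval⦄, s ≠ 0 → s ≠ 1 → p k s = p k' s' → k = k' ∧ s = s'

namespace IsNaturalForm

variable {γ : C(unitInterval, U)} {n : ℕ} {c : ℕ → κ} {F : ℝ → U} {L : ℝ} {ψ : P.Hom 1 L}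

theorem exists_eq_add (h : IsNaturalForm p γ n c F ψ) (s : unitInterval) :
    ∃ i < n, ∃ t : unitInterval, (ψ.1 s : ℝ) = i + t :=
  exists_eq_natCast_add h.one_le (ψ.1 s).2.1 ((ψ.1 s).2.2.trans_eq h.length_eq)

theorem exists_apply_eq (h : IsNaturalForm p γ n c F ψ) {x : ℝ} (h0 : 0 ≤ x) (h1 : x ≤ n) :
    ∃ s, (ψ.1 s : ℝ) = x := by
  obtain ⟨s, hs⟩ := ψ.2.surjective ⟨x, h0, h1.trans_eq h.length_eq.symm⟩
  exact ⟨s, congrArg Subtype.val hs⟩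

/-- The Moore composition `F` is continuous on `[0, n]`. -/
theorem continuous (h : IsNaturalForm p γ n c F ψ) : Continuous fun x : Seg L => F x := by
  -- A continuous surjection from a compact space to a Hausdorff one is a quotient map, so
  -- continuity of `F` follows from that of `F ∘ ψ = γ`.
  have hq : IsQuotientMap ψ.1 := ψ.1.continuous.isClosedMap.isQuotientMap ψ.1.continuous
    ψ.2.surjective
  rw [hq.continuous_iff]
  exact γ.continuous.congr h.factor

variable {n' : ℕ} {c' : ℕ → κ} {F' : ℝ → U} {L' : ℝ} {ψ' : P.Hom 1 L'}

/-- Compare the positions of `ψ s` and `ψ' s` within their unit segments. If one is interior,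
separation makes the two equal; otherwise both are `0` or `1`. -/
theorem sub_mem_range_intCast (hp : SeparatesInterior p) (h : IsNaturalForm p γ n c F ψ)
    (h' : IsNaturalForm p γ n' c' F' ψ') (s : unitInterval) :
    (ψ.1 s : ℝ) - ψ'.1 s ∈ Set.range ((↑) : ℤ → ℝ) := by
  obtain ⟨i, hi, t, ht⟩ := h.exists_eq_add s
  obtain ⟨i', hi', t', ht'⟩ := h'.exists_eq_add s
  have key : p (c i) t = p (c' i') t' := by
    rw [← h.apply_add i hi, ← h'.apply_add i' hi', ← ht, ← ht', ← h.factor, ← h'.factor]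
  have h_int : ∃ k : ℤ, (t : ℝ) - t' = k := by
    by_cases ht0 : t ≠ 0 ∧ t ≠ 1
    · exact ⟨0, by rw [(hp ht0.1 ht0.2 key).2]; simp⟩
    by_cases ht0' : t' ≠ 0 ∧ t' ≠ 1
    · exact ⟨0, by rw [(hp ht0'.1 ht0'.2 key.symm).2]; simp⟩
    have hz : ∀ u : unitInterval, ¬ (u ≠ 0 ∧ u ≠ 1) → ∃ k : ℤ, (u : ℝ) = k := fun u hu => by
      by_cases hu0 : u = 0
      · exact ⟨0, by simp [hu0]⟩
      · exact ⟨1, by simp [not_not.1 fun hu1 => hu ⟨hu0, hu1⟩]⟩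
    obtain ⟨k, hk⟩ := hz t ht0
    obtain ⟨k', hk'⟩ := hz t' ht0'
    exact ⟨k - k', by rw [hk, hk']; push_cast; ring⟩
  obtain ⟨k, hk⟩ := h_int
  refine ⟨i - i' + k, ?_⟩
  push_cast
  rw [ht, ht', ← hk]
  ring

/-- The reparametrization of a natural form is unique. -/
theorem apply_eq (hp : SeparatesInterior p) (h : IsNaturalForm p γ n c F ψ)
    (h' : IsNaturalForm p γ n' c' F' ψ') (s : unitInterval) : (ψ.1 s : ℝ) = ψ'.1 s := by
  have hc : Continuous fun s : unitInterval => (ψ.1 s : ℝ) - ψ'.1 s :=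
    (continuous_subtype_val.comp ψ.1.continuous).sub (continuous_subtype_val.comp ψ'.1.continuous)
  -- A continuous map from a connected space into the discrete subset `ℤ` of `ℝ` is constant; here
  -- its value at `0` is `0`.
  have hd : _root_.IsDiscrete (Set.range ((↑) : ℤ → ℝ)) :=
    Int.isClosedEmbedding_coe_real.isInducing.isDiscrete_range
  have h0 := isPreconnected_univ.constant_of_mapsTo hd hc.continuousOn
    (fun s _ => sub_mem_range_intCast hp h h' s) (Set.mem_univ s) (Set.mem_univ 0)
  simp only [ψ.map_zero, ψ'.map_zero, sub_self] at h0
  exact sub_eq_zero.1 h0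

theorem length_unique (hp : SeparatesInterior p) (h : IsNaturalForm p γ n c F ψ)
    (h' : IsNaturalForm p γ n' c' F' ψ') : n = n' := by
  have h1 := apply_eq hp h h' 1
  rw [ψ.map_one, ψ'.map_one, h.length_eq, h'.length_eq] at h1
  exact_mod_cast h1

theorem index_unique (hp : SeparatesInterior p) (h : IsNaturalForm p γ n c F ψ)
    (h' : IsNaturalForm p γ n' c' F' ψ') {i : ℕ} (hi : i < n) : c i = c' i := by
  have hn := length_unique hp h h'
  -- Any parameter other than `0` and `1` would identify the cell.
  let t : unitInterval := ⟨1 / 2, by norm_num, by norm_num⟩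
  have hin : ((i + 1 : ℕ) : ℝ) ≤ n := Nat.cast_le.2 hi
  push_cast at hin
  obtain ⟨s, hs⟩ := h.exists_apply_eq (x := i + t) (add_nonneg (Nat.cast_nonneg i) t.2.1)
    (by linarith [t.2.2])
  have ht0 : t ≠ 0 := fun h => by
    have := congrArg Subtype.val h
    norm_num [t] at this
  have ht1 : t ≠ 1 := fun h => by
    have := congrArg Subtype.val h
    norm_num [t] at this
  refine (hp ht0 ht1 (k' := c' i) (s' := t) ?_).1
  rw [← h.apply_add i hi, ← h'.apply_add i (hn ▸ hi), ← hs, ← h.factor, h'.factor,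
    apply_eq hp h h']

end IsNaturalForm

/-- Every nontrivial interval contains two distinct points interior to a single unit segment, and
one path `p k` separates them. This gives regularity. -/
theorem SeparatesInterior.exists_ne_of_lt (hp : SeparatesInterior p) {n : ℕ} {c : ℕ → κ}
    {F : ℝ → U} (hF : ∀ i < n, ∀ t : unitInterval, F (i + t) = p (c i) t) {a b : ℝ}
    (ha : 0 ≤ a) (hb : b ≤ n) (hab : a < b) :
    ∃ x ∈ Set.Icc a b, ∃ y ∈ Set.Icc a b, F x ≠ F y := by
  obtain ⟨i, h1, h2⟩ : ∃ i : ℕ, (i : ℝ) ≤ a ∧ a < i + 1 :=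
    ⟨⌊a⌋₊, Nat.floor_le ha, Nat.lt_floor_add_one a⟩
  have hin : i < n := Nat.cast_lt.1 (h1.trans_lt (hab.trans_le hb))
  obtain ⟨x, hx1, hx2⟩ := exists_between (lt_min hab h2)
  obtain ⟨y, hy1, hy2⟩ := exists_between hx2
  rw [lt_min_iff] at hx2 hy2
  refine ⟨x, ⟨hx1.le, hx2.1.le⟩, y, ⟨(hx1.trans hy1).le, hy2.1.le⟩, fun h => ?_⟩
  let s : unitInterval := ⟨x - i, by linarith, by linarith⟩
  let t : unitInterval := ⟨y - i, by linarith, by linarith⟩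
  have hs : (i : ℝ) + s = x := by simp [s]
  have ht : (i : ℝ) + t = y := by simp [t]
  rw [← hs, ← ht, hF i hin, hF i hin] at h
  have hs0 : s ≠ 0 := fun h => by
    have : x - i = 0 := congrArg Subtype.val h
    linarith
  have hs1 : s ≠ 1 := fun h => by
    have : x - i = 1 := congrArg Subtype.val h
    linarith
  have h3 : x - i = y - i := congrArg Subtype.val (hp hs0 hs1 h).2
  linarith

/-- The Moore composition underlying a natural form, as a Moore path. -/
theorem IsNaturalForm.exists_moorePath (hp : SeparatesInterior p) {γ : C(unitInterval, U)} {n : ℕ}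
    {c : ℕ → κ} {F : ℝ → U} {L : ℝ} {ψ : P.Hom 1 L} (h : IsNaturalForm p γ n c F ψ) :
    ∃ N : MoorePath U, N.IsRegular ∧ N.length = n ∧
      ∀ i < n, ∀ (t : unitInterval) (s : Seg N.length), (s : ℝ) = i + t → N.toMap s = p (c i) t := by
  have hL : (1 : ℝ) ≤ L := h.length_eq ▸ (by exact_mod_cast h.one_le)
  have key : ∀ a b : Seg L, a < b → ∃ x ∈ Set.Icc a b, ∃ y ∈ Set.Icc a b, F x ≠ F y :=
    fun a b hab => by
      obtain ⟨x, hx, y, hy, hxy⟩ := hp.exists_ne_of_lt h.apply_add a.2.1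
        (b.2.2.trans_eq h.length_eq) hab
      exact ⟨⟨x, a.2.1.trans hx.1, hx.2.trans b.2.2⟩, hx, ⟨y, a.2.1.trans hy.1, hy.2.trans b.2.2⟩,
        hy, hxy⟩
  let N : MoorePath U :=
    { length := L
      length_pos := by linarith
      toMap := ⟨fun x => F x, h.continuous⟩
      nonconstant := by
        obtain ⟨x, _, y, _, hxy⟩ := key ⟨0, le_rfl, by linarith⟩ ⟨L, by linarith, le_rfl⟩
          (Subtype.coe_lt_coe.1 (by change (0 : ℝ) < L; linarith))
        exact ⟨x, y, hxy⟩ }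
  refine ⟨N, fun a b hab => ?_, h.length_eq, fun i hi t s hs => ?_⟩
  · obtain ⟨x, hx, y, hy, hxy⟩ := key a b hab.1
    exact hxy (hab.2.1 x hx y hy)
  · change F s = _
    rw [hs, h.apply_add i hi]

end NaturalForm

/-! ### Decompositions and natural forms -/

namespace CellularTower

variable {c : Convention} {P : Reparam} {lam : Ordinal.{w}} (X : CellularTower.{w, u} c P lam)

/-- The paths `ĝ_ν δ_z` for `ν < lam` and `z ∈ 𝐃^{n_ν} \ 𝐒^{n_ν - 1}`. -/
def interiorPath (k : Σ ν : Set.Iio lam, InteriorDisk.{u} (X.dim ν)) :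
    C(unitInterval, X.total.carrier) :=
  X.cellPath k.1 k.2.1

variable {X} {γ : C(unitInterval, X.total.carrier)}

namespace Decomposition

variable {n : ℕ} (d : X.Decomposition γ n)

theorem tensor_apply (i : Fin n) (t : Seg (d.ℓ i)) (s : Seg 1)
    (hs : (s : ℝ) = partialSum d.ℓ i + t) :
    (d.tensor.1 s : ℝ) = i + (d.φ i).1 ((P.mu (d.ℓ i) (d.ℓ_pos i)).1 t) := by
  rw [Decomposition.tensor, Reparam.tensor_apply _ _ _ _ i t s hs, partialSum_one]
  rfl

theorem apply_eq (i : Fin n) (t : Seg (d.ℓ i)) (s : Seg 1)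
    (hs : (s : ℝ) = partialSum d.ℓ i + t) :
    γ s = X.interiorPath (d.cell i) ((d.φ i).1 ((P.mu (d.ℓ i) (d.ℓ_pos i)).1 t)) :=
  d.isMooreComposition.2 i t s hs

/-- Both sides are the value of `γ` at the time where the two pieces meet. -/
theorem composable {i : ℕ} (h : i + 1 < n) :
    X.interiorPath (d.cell ⟨i, (Nat.lt_succ_self i).trans h⟩) 1
      = X.interiorPath (d.cell ⟨i + 1, h⟩) 0 := by
  set j : Fin n := ⟨i, (Nat.lt_succ_self i).trans h⟩
  have h0 : ∀ i, 0 ≤ d.ℓ i := fun i => (d.ℓ_pos i).le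
  have hj := partialSum_nonneg h0 ⟨i + 1, h⟩
  have hj' := (partialSum_add_le_sum h0 ⟨i + 1, h⟩).trans_eq d.sum_ℓ
  let s : Seg 1 := ⟨partialSum d.ℓ ⟨i + 1, h⟩, hj, by linarith [h0 ⟨i + 1, h⟩]⟩
  have h1 := d.apply_eq j ⟨d.ℓ j, h0 j, le_rfl⟩ s (partialSum_succ d.ℓ h)
  have h2 := d.apply_eq ⟨i + 1, h⟩ ⟨0, le_rfl, h0 _⟩ s (add_zero _).symm
  rw [show (P.mu (d.ℓ j) (d.ℓ_pos j)).1 ⟨d.ℓ j, h0 j, le_rfl⟩ = 1 from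
    Subtype.ext (div_self (d.ℓ_pos j).ne'),
    show (d.φ j).1 1 = 1 from Subtype.ext (d.φ j).map_one] at h1
  rw [show (P.mu (d.ℓ ⟨i + 1, h⟩) (d.ℓ_pos _)).1 ⟨0, le_rfl, h0 _⟩ = 0 from
    Subtype.ext (zero_div _),
    show (d.φ ⟨i + 1, h⟩).1 0 = 0 from Subtype.ext (d.φ ⟨i + 1, h⟩).map_zero] at h2
  exact h1.symm.trans h2

/-- The value of `γ` at `s` depends only on the value of the tensor product at `s`, even where the
latter stops and even when an integer is written in two ways as `i + t`. -/
theorem apply_eq_of_tensor_eq (i : Fin n) (t : unitInterval) (s : Seg 1)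
    (hs : (d.tensor.1 s : ℝ) = i + t) : γ s = X.interiorPath (d.cell i) t := by
  obtain ⟨j, u, hu⟩ := exists_eq_partialSum_add d.one_le (fun i => (d.ℓ_pos i).le) s.2.1
    (s.2.2.trans_eq d.sum_ℓ.symm)
  have h1 := d.tensor_apply j u s hu
  rw [d.apply_eq j u s hu]
  set t' : unitInterval := (d.φ j).1 ((P.mu (d.ℓ j) (d.ℓ_pos j)).1 u)
  have h2 : (i : ℝ) + t = j + t' := hs.symm.trans h1
  have ht0 := t.2.1
  have ht1 := t.2.2
  have ht0' := t'.2.1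
  have ht1' := t'.2.2
  obtain ⟨i, hi⟩ := i
  obtain ⟨j, hj⟩ := j
  simp only at h2
  -- Since `i + t = j + t'` with `t, t' ∈ [0, 1]`, the indices differ by at most one; if they
  -- differ, the point is the junction of adjacent pieces and `composable` applies.
  have hij : (i : ℝ) < (j + 2 : ℕ) := by
    push_cast
    linarith
  have hji : (j : ℝ) < (i + 2 : ℕ) := by
    push_cast
    linarith
  rw [Nat.cast_lt] at hij hji
  obtain rfl | rfl | rfl : j = i ∨ j = i + 1 ∨ i = j + 1 := by omega
  · rw [show t' = t from Subtype.ext (by linarith)]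
  · push_cast at h2
    rw [show t' = 0 from Subtype.ext (by change (t' : ℝ) = 0; linarith),
      show t = 1 from Subtype.ext (by change (t : ℝ) = 1; linarith)]
    exact (d.composable hj).symm
  · push_cast at h2
    rw [show t' = 1 from Subtype.ext (by change (t' : ℝ) = 1; linarith),
      show t = 0 from Subtype.ext (by change (t : ℝ) = 0; linarith)]
    exact d.composable hi

/-- The function `F` is `γ` composed with a set-theoretic section `g` of the tensor product; by
`apply_eq_of_tensor_eq` the choice of section is immaterial. -/
theorem exists_isNaturalForm : ∃ (k : ℕ → Σ ν : Set.Iio lam, InteriorDisk.{u} (X.dim ν))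
    (F : ℝ → X.total.carrier), (∀ i : Fin n, k i = d.cell i) ∧
      IsNaturalForm X.interiorPath γ n k F d.tensor := by
  have hn : (0 : ℝ) ≤ n := Nat.cast_nonneg n
  choose g hg using d.tensor.2.surjective
  let k : ℕ → Σ ν : Set.Iio lam, InteriorDisk.{u} (X.dim ν) :=
    fun i => if h : i < n then d.cell ⟨i, h⟩ else d.cell ⟨0, d.one_le⟩
  have hk : ∀ (i : ℕ) (hi : i < n), k i = d.cell ⟨i, hi⟩ := fun i hi => dif_pos hi
  have hF : ∀ i < n, ∀ t : unitInterval,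
      γ (g (Set.projIcc 0 (n : ℝ) hn (i + t))) = X.interiorPath (k i) t := fun i hi t => by
    rw [hk i hi]
    refine d.apply_eq_of_tensor_eq ⟨i, hi⟩ t _ ?_
    have hin : ((i + 1 : ℕ) : ℝ) ≤ n := Nat.cast_le.2 hi
    push_cast at hin
    rw [hg, Set.projIcc_of_mem hn ⟨add_nonneg (Nat.cast_nonneg i) t.2.1, by linarith [t.2.2]⟩]
  refine ⟨k, fun x => γ (g (Set.projIcc 0 (n : ℝ) hn x)), fun i => hk i i.2,
    ⟨rfl, d.one_le, hF, fun s => ?_⟩⟩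
  obtain ⟨i, hi, t, ht⟩ := exists_eq_natCast_add d.one_le (d.tensor.1 s).2.1 (d.tensor.1 s).2.2
  rw [ht, hF i hi, hk i hi]
  exact d.apply_eq_of_tensor_eq ⟨i, hi⟩ t s ht

end Decomposition

theorem nonempty_decomposition_of_isNaturalForm {n : ℕ}
    {k : ℕ → Σ ν : Set.Iio lam, InteriorDisk.{u} (X.dim ν)} {F : ℝ → X.total.carrier} {L : ℝ}
    {ψ : P.Hom 1 L} (h : IsNaturalForm X.interiorPath γ n k F ψ) :
    Nonempty (X.Decomposition γ n) := by
  have hn := h.one_le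
  -- For `𝒫 = ℳ` the fibre of `ψ` over an integer may be an interval. The extreme cuts must be
  -- exactly `0` and `1` for the lengths to sum to `1`; the others are arbitrary.
  have hex : ∀ i : ℕ, i ≤ n → ∃ s : Seg 1, (ψ.1 s : ℝ) = i ∧ (i = 0 → s = 0) ∧ (i = n → s = 1) := by
    intro i hi
    by_cases h0 : i = 0
    · exact ⟨0, by rw [ψ.map_zero, h0, Nat.cast_zero], fun _ => rfl, fun h1 => by omega⟩
    by_cases h1 : i = n
    · exact ⟨1, by rw [ψ.map_one, h.length_eq, h1], fun h2 => absurd h2 h0, fun _ => rfl⟩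
    obtain ⟨s, hs⟩ := h.exists_apply_eq (x := i) (Nat.cast_nonneg i) (Nat.cast_le.2 hi)
    exact ⟨s, hs, fun h2 => absurd h2 h0, fun h2 => absurd h2 h1⟩
  choose! t ht ht0 ht1 using hex
  have hlt : ∀ i < n, t i < t (i + 1) := fun i hi => by
    by_contra hle
    have h2 : (ψ.1 (t (i + 1)) : ℝ) ≤ ψ.1 (t i) := ψ.2.monotone (not_lt.1 hle)
    rw [ht i hi.le, ht (i + 1) hi] at h2
    push_cast at h2
    linarith
  have hφ : ∀ i : Fin n, ∃ φ : P.Hom 1 1, ∀ s u : Seg 1,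
      (s : ℝ) = t i + u * (t (i + 1) - t i) → (ψ.1 s : ℝ) = i + φ.1 u := fun i =>
    Reparam.exists_restrict ψ (hlt i i.2).le (ht i i.2.le)
      (by rw [ht (i + 1) i.2, Nat.cast_add, Nat.cast_one])
  choose φ hφ using hφ
  have hpos : ∀ i : Fin n, 0 < (t (i + 1) : ℝ) - t i := fun i => sub_pos.2 (hlt i i.2)
  have hsum : ∑ i : Fin n, ((t (i + 1) : ℝ) - t i) = 1 := by
    rw [Fin.sum_univ_eq_sum_range (fun i => (t (i + 1) : ℝ) - t i), Finset.sum_range_sub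
      (fun i => (t i : ℝ)), ht0 0 (Nat.zero_le n) rfl, ht1 n le_rfl rfl]
    simp
  exact ⟨
    { one_le := hn
      cell := fun i => k i
      φ := φ
      ℓ := fun i => t (i + 1) - t i
      ℓ_pos := hpos
      sum_ℓ := hsum
      isMooreComposition := ⟨hsum, fun i u s hs => by
        rw [partialSum_sub (fun i => (t i : ℝ)), ht0 0 (Nat.zero_le n) rfl] at hs
        rw [h.factor, hφ i s ((P.mu _ (hpos i)).1 u), h.apply_add i i.2]
        · rfl
        · change (s : ℝ) = t i + (u : ℝ) / (t (i + 1) - t i) * (t (i + 1) - t i)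
          rw [hs, div_mul_cancel₀ _ (hpos i).ne']
          simp⟩ }⟩

end CellularTower

/-! ### Subspaces and the generation of states and paths by colimits -/

theorem normalizedComp_zero {U : Type*} [TopologicalSpace U] (γ₁ γ₂ : C(unitInterval, U))
    (h : γ₁ 1 = γ₂ 0) : normalizedComp γ₁ γ₂ h 0 = γ₁ 0 :=
  Path.source _

theorem normalizedComp_one {U : Type*} [TopologicalSpace U] (γ₁ γ₂ : C(unitInterval, U))
    (h : γ₁ 1 = γ₂ 0) : normalizedComp γ₁ γ₂ h 1 = γ₂ 1 :=
  Path.target _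

theorem comp_normalizedComp {U V : Type*} [TopologicalSpace U] [TopologicalSpace V]
    (f : C(U, V)) (γ₁ γ₂ : C(unitInterval, U)) (h : γ₁ 1 = γ₂ 0) :
    f.comp (normalizedComp γ₁ γ₂ h)
      = normalizedComp (f.comp γ₁) (f.comp γ₂) (congrArg f h) := by
  ext t
  change f (Path.trans _ _ t) = Path.trans _ _ t
  rw [Path.trans_apply, Path.trans_apply]
  split_ifs <;> rfl

namespace MDSpace

variable {c : Convention} {P : Reparam}

/-- A set of paths stable under reparametrization and normalized composition. -/
structure IsPathClosed (P : Reparam) {U : Type*} [TopologicalSpace U]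
    (Q : Set C(unitInterval, U)) : Prop where
  reparam_mem : ∀ γ ∈ Q, ∀ φ : P.Hom 1 1, γ.comp φ.1 ∈ Q
  comp_mem : ∀ γ₁ ∈ Q, ∀ γ₂ ∈ Q, ∀ h : γ₁ 1 = γ₂ 0, normalizedComp γ₁ γ₂ h ∈ Q

/-- The states of `A` are sent by `f` into `S`, and its execution paths into `Q`. -/
structure MapsInto {A T : MDSpace.{u} c P} (f : A ⟶ T) (S : Set T.carrier)
    (Q : Set C(unitInterval, T.carrier)) : Prop where
  states : ∀ x ∈ A.states, MDSpace.Hom.toMap f x ∈ S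
  paths : ∀ γ ∈ A.paths, (MDSpace.Hom.toMap f).comp γ ∈ Q

variable {Y T : MDSpace.{u} c P} {S : Set T.carrier} {Q : Set C(unitInterval, T.carrier)}

/-- The subobject of `Y`, with the same underlying space, of the states and execution paths which
are sent into `S` and `Q` by `t : Y ⟶ T`. -/
def restrict (t : Y ⟶ T) (S : Set T.carrier) (hQ : IsPathClosed P Q) : MDSpace.{u} c P where
  carrier := Y.carrier
  admissible := Y.admissible
  states := {x | x ∈ Y.states ∧ MDSpace.Hom.toMap t x ∈ S}
  paths := {γ | γ ∈ Y.paths ∧ MDSpace.Hom.toMap t (γ 0) ∈ S ∧ MDSpace.Hom.toMap t (γ 1) ∈ S ∧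
    (MDSpace.Hom.toMap t).comp γ ∈ Q}
  source_mem γ hγ := ⟨Y.source_mem γ hγ.1, hγ.2.1⟩
  target_mem γ hγ := ⟨Y.target_mem γ hγ.1, hγ.2.2.1⟩
  reparam_mem γ hγ φ := by
    have h0 : φ.1 0 = 0 := Subtype.ext φ.map_zero
    have h1 : φ.1 1 = 1 := Subtype.ext φ.map_one
    refine ⟨Y.reparam_mem γ hγ.1 φ, ?_, ?_, hQ.reparam_mem _ hγ.2.2.2 φ⟩
    · change MDSpace.Hom.toMap t (γ (φ.1 0)) ∈ S
      rw [h0]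
      exact hγ.2.1
    · change MDSpace.Hom.toMap t (γ (φ.1 1)) ∈ S
      rw [h1]
      exact hγ.2.2.1
  comp_mem γ₁ h₁ γ₂ h₂ h := by
    refine ⟨Y.comp_mem γ₁ h₁.1 γ₂ h₂.1 h, ?_, ?_, ?_⟩
    · rw [normalizedComp_zero]
      exact h₁.2.1
    · rw [normalizedComp_one]
      exact h₂.2.2.1
    · rw [comp_normalizedComp]
      exact hQ.comp_mem _ h₁.2.2.2 _ h₂.2.2.2 _

variable (t : Y ⟶ T) (hQ : IsPathClosed P Q)

/-- The inclusion of the subobject. -/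
def restrictIncl : restrict t S hQ ⟶ Y :=
  MDSpace.Hom.mk (X := restrict t S hQ) (Y := Y) (ContinuousMap.id _) (fun _ h => h.1)
    fun _ h => h.1

variable {t}

/-- The factorization of a map through the subobject. -/
def restrictLift {A : MDSpace.{u} c P} (f : A ⟶ Y) (hf : MapsInto (f ≫ t) S Q) :
    A ⟶ restrict t S hQ :=
  MDSpace.Hom.mk (X := A) (Y := restrict t S hQ) (MDSpace.Hom.toMap (X := A) (Y := Y) f)
    (fun x h => ⟨MDSpace.Hom.map_states f x h, hf.states x h⟩)
    fun γ h => ⟨MDSpace.Hom.map_paths f γ h, hf.states _ (A.source_mem γ h),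
      hf.states _ (A.target_mem γ h), hf.paths γ h⟩

theorem restrictLift_incl {A : MDSpace.{u} c P} (f : A ⟶ Y) (hf : MapsInto (f ≫ t) S Q) :
    restrictLift hQ f hf ≫ restrictIncl t hQ = f := rfl

instance : Mono (restrictIncl (S := S) t hQ) where
  right_cancellation {A} _ _ h :=
    MDSpace.Hom.ext (X := A) (Y := restrict t S hQ)
      (congrArg (MDSpace.Hom.toMap (X := A) (Y := Y)) h)

variable {hQ}

/-- The section is the identity on points, so each state and path of `Y` already satisfies the
conditions defining the subobject. -/
theorem mapsInto_of_section (s : Y ⟶ restrict t S hQ) (hs : s ≫ restrictIncl t hQ = 𝟙 Y) :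
    MapsInto t S Q := by
  have key : MDSpace.Hom.toMap s = ContinuousMap.id Y.carrier := congrArg MDSpace.Hom.toMap hs
  refine ⟨fun x hx => ?_, fun γ hγ => ?_⟩
  · have h := MDSpace.Hom.map_states s x hx
    rw [key] at h
    exact h.2
  · have h := MDSpace.Hom.map_paths s γ hγ
    rw [key] at h
    exact h.2.2.2

/-- Both legs factor through the subobject, so the universal property yields a section of its
inclusion. This expresses that states and paths of a pushout are generated by the legs. -/
theorem MapsInto.of_isPushout (hQ : IsPathClosed P Q) {A B C : MDSpace.{u} c P} {f : A ⟶ B} {g : A ⟶ C} {i : B ⟶ Y}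
    {j : C ⟶ Y} (h : IsPushout f g i j) (hi : MapsInto (i ≫ t) S Q)
    (hj : MapsInto (j ≫ t) S Q) : MapsInto t S Q := by
  refine mapsInto_of_section (hQ := hQ) (h.desc (restrictLift hQ i hi) (restrictLift hQ j hj) ?_) ?_
  · rw [← cancel_mono (restrictIncl t hQ)]
    exact h.w
  · apply h.hom_ext
    · rw [h.inl_desc_assoc, restrictLift_incl, Category.comp_id]
    · rw [h.inr_desc_assoc, restrictLift_incl, Category.comp_id]

theorem MapsInto.of_isColimit (hQ : IsPathClosed P Q) {J : Type*} [Category J] {F : J ⥤ MDSpace.{u} c P} {k : Cocone F}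
    (hk : IsColimit k) {t : k.pt ⟶ T} (h : ∀ j, MapsInto (k.ι.app j ≫ t) S Q) :
    MapsInto t S Q := by
  let l : Cocone F :=
    { pt := restrict t S hQ
      ι :=
        { app j := restrictLift hQ (k.ι.app j) (h j)
          naturality i j f := by
            rw [← cancel_mono (restrictIncl t hQ)]
            exact k.ι.naturality f } }
  refine mapsInto_of_section (hQ := hQ) (hk.desc l) (hk.hom_ext fun j => ?_)
  rw [hk.fac_assoc, Category.comp_id]
  rfl

end MDSpace

/-! ### Extension of real functions -/

namespace MDSpace

variable (c : Convention) (P : Reparam)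

/-- A space, all points and paths of which are states and execution paths. -/
def chaotic (T : Type u) [TopologicalSpace T] [DeltaGeneratedSpace T] [T2Space T] :
    MDSpace.{u} c P where
  carrier := T
  admissible := c.admissible_of_t2 T
  states := Set.univ
  paths := Set.univ
  source_mem _ _ := trivial
  target_mem _ _ := trivial
  reparam_mem _ _ _ := trivial
  comp_mem _ _ _ _ _ := trivial

variable {c P}

/-- A continuous map with values in a space, all points and paths of which are states and execution
paths. -/
def toChaotic {T : Type u} [TopologicalSpace T] [DeltaGeneratedSpace T] [T2Space T]
    {Y : MDSpace.{u} c P} (f : C(Y.carrier, T)) : Y ⟶ chaotic c P T :=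
  MDSpace.Hom.mk (X := Y) (Y := chaotic c P T) f (fun _ _ => trivial) fun _ _ => trivial

variable (c P) in
/-- The map from the real line to the point. -/
def realToPoint : chaotic c P (ULift.{u} ℝ) ⟶ chaotic c P PUnit.{u + 1} :=
  toChaotic (Y := chaotic c P (ULift.{u} ℝ)) ⟨fun _ => PUnit.unit, continuous_const⟩

theorem hom_point_eq {Y : MDSpace.{u} c P} (f g : Y ⟶ chaotic c P PUnit.{u + 1}) : f = g :=
  MDSpace.Hom.ext (X := Y) (Y := chaotic c P PUnit.{u + 1}) (ContinuousMap.ext fun _ => rfl)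

/-- This is the Tietze extension theorem on the compact Hausdorff globe of the disk; the triangle
over the point commutes automatically. -/
instance hasLiftingProperty_globMap (n : ℕ) :
    HasLiftingProperty (globMap c P (sphereIncl.{u} n)) (realToPoint c P) where
  sq_hasLift {f _} _ := by
    obtain ⟨g, hg⟩ := ContinuousMap.exists_extension' (isClosedEmbedding_map_sphereIncl.{u} n)
      ((⟨ULift.down, continuous_uliftDown⟩ : C(ULift.{u} ℝ, ℝ)).comp (MDSpace.Hom.toMap f))
    refine ⟨⟨⟨toChaotic (Y := glob c P (Disk.{u} n))
      ((⟨ULift.up, continuous_uliftUp⟩ : C(ℝ, ULift.{u} ℝ)).comp g), ?_, hom_point_eq _ _⟩⟩⟩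
    refine MDSpace.Hom.ext (X := glob c P (Sphere.{u} n)) (Y := chaotic c P (ULift.{u} ℝ))
      (ContinuousMap.ext fun x => ?_)
    exact ULift.ext _ _ (congrFun hg x)

end MDSpace

namespace CellularTower

variable {c : Convention} {P : Reparam} {lam : Ordinal.{w}} (X : CellularTower.{w, u} c P lam)

/-- The map `X_ν → X_lam`. -/
def toTotal (j : Set.Iic lam) : X.functor.obj j ⟶ X.total :=
  X.functor.map (homOfLE (Subtype.mk_le_mk.2 j.2))

theorem map_toTotal {i j : Set.Iic lam} (h : i ≤ j) :
    X.functor.map (homOfLE h) ≫ X.toTotal j = X.toTotal i :=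
  (X.functor.map_comp _ _).symm

theorem toTotal_map {i j : Set.Iic lam} (h : i ≤ j) (x : (X.functor.obj i).carrier) :
    MDSpace.Hom.toMap (X.toTotal j) (MDSpace.Hom.toMap (X.functor.map (homOfLE h)) x)
      = MDSpace.Hom.toMap (X.toTotal i) x :=
  congrArg (fun f => MDSpace.Hom.toMap f x) (X.map_toTotal h)

theorem cellMap_globMap (ν : Set.Iio lam) :
    globMap c P (sphereIncl (X.dim ν)) ≫ X.cellMap ν
      = X.attach ν ≫ X.toTotal ⟨ν.1, Set.mem_Iic.2 (le_of_lt ν.2)⟩ := by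
  change _ ≫ X.char ν ≫ X.toTotal _ = _
  rw [← Category.assoc, ← (X.isPushout ν).w, Category.assoc]
  exact congrArg (X.attach ν ≫ ·) (X.map_toTotal _)

/-- The transfinite composition of the maps `X_ν → X_{ν + 1}`. -/
noncomputable def transfiniteComposition (W : MorphismProperty (MDSpace.{u} c P))
    (hW : ∀ ν : Set.Iio lam, W (X.functor.map (homOfLE (Subtype.mk_le_mk.2 (Order.le_succ ν.1)) :
      (⟨ν.1, Set.mem_Iic.2 (le_of_lt ν.2)⟩ : Set.Iic lam) ⟶
        ⟨Order.succ ν.1, Set.mem_Iic.2 (Order.succ_le_of_lt ν.2)⟩))) :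
    W.TransfiniteCompositionOfShape (Set.Iic lam) (X.toTotal ⊥) where
  F := X.functor
  isoBot := Iso.refl _
  isWellOrderContinuous := X.continuous
  incl :=
    { app j := X.toTotal j
      naturality i j f := (X.map_toTotal (leOfHom f)).trans (Category.comp_id _).symm }
  isColimit := colimitOfDiagramTerminal isTerminalTop _
  fac := Category.id_comp _
  map_mem j hj := by
    have hlt : j.1 < lam := lt_of_le_of_ne j.2 fun h => hj fun k _ => by
      rw [← Subtype.coe_le_coe, h]
      exact k.2
    have := hW ⟨j.1, hlt⟩
    rw [← W.arrow_mk_mem_toSet_iff] at this ⊢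
    -- The successor computed in `Set.Iic lam` agrees with the ordinal successor only away from the
    -- top, so the two arrows are identified before applying the functor.
    have eq : Arrow.mk (homOfLE (Order.le_succ j)) =
        Arrow.mk (homOfLE (Subtype.mk_le_mk.2 (Order.le_succ j.1)) : j ⟶
          (⟨Order.succ j.1, Set.mem_Iic.2 (Order.succ_le_of_lt hlt)⟩ : Set.Iic lam)) :=
      Arrow.ext rfl (Set.Iic.succ_eq_of_not_isMax hj) rfl
    have eq' := congr_arg X.functor.mapArrow.obj eq
    convert! this using 1

/-- Every continuous real function on `X_ν` extends to `X_lam`. -/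
theorem exists_extension (j : Set.Iic lam) (f : C((X.functor.obj j).carrier, ℝ)) :
    ∃ g : C(X.total.carrier, ℝ), ∀ x, g (MDSpace.Hom.toMap (X.toTotal j) x) = f x := by
  -- Truncating the tower to the indices `≥ j` presents `X_j → X_lam` itself as a transfinite
  -- composition.
  let h := (X.transfiniteComposition
    (fun _ _ i => HasLiftingProperty i (MDSpace.realToPoint c P))
    fun ν => (X.isPushout ν).hasLiftingProperty _).ici j
  have hlift : HasLiftingProperty (X.toTotal j) (MDSpace.realToPoint c P) :=
    HasLiftingProperty.transfiniteComposition.hasLiftingProperty_ι_app_bot h.isColimit h.map_mem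
  let f' : X.functor.obj j ⟶ MDSpace.chaotic c P (ULift.{u} ℝ) :=
    MDSpace.toChaotic ((⟨ULift.up, continuous_uliftUp⟩ : C(ℝ, ULift.{u} ℝ)).comp f)
  have sq : CommSq f' (X.toTotal j) (MDSpace.realToPoint c P)
    (MDSpace.toChaotic ⟨fun _ => PUnit.unit, continuous_const⟩) := ⟨MDSpace.hom_point_eq _ _⟩
  refine ⟨(⟨ULift.down, continuous_uliftDown⟩ : C(ULift.{u} ℝ, ℝ)).comp
    (MDSpace.Hom.toMap sq.lift), fun x => ?_⟩
  exact congrArg (fun g : X.functor.obj j ⟶ MDSpace.chaotic c P (ULift.{u} ℝ) =>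
    (show ULift.{u} ℝ from MDSpace.Hom.toMap g x).down) sq.fac_left

end CellularTower

namespace CellularTower

variable {c : Convention} {P : Reparam} {lam : Ordinal.{w}} (X : CellularTower.{w, u} c P lam)

/-! ### Injectivity of the cells -/

/-- A real function on the globe of a disk which vanishes on the globe of the sphere extends to
`X_lam` by a function which vanishes on `X_ν`. -/
theorem exists_bump (ν : Set.Iio lam) (f : C(GlobCarrier (Disk.{u} (X.dim ν)), ℝ))
    (hf : ∀ x, f (GlobCarrier.map (sphereIncl (X.dim ν)) x) = 0) :
    ∃ g : C(X.total.carrier, ℝ),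
      (∀ x, g (MDSpace.Hom.toMap (X.toTotal ⟨ν.1, Set.mem_Iic.2 (le_of_lt ν.2)⟩) x) = 0) ∧
      ∀ x, g (MDSpace.Hom.toMap (X.cellMap ν) x) = f x := by
  let up : C(ℝ, ULift.{u} ℝ) := ⟨ULift.up, continuous_uliftUp⟩
  let zero : X.functor.obj ⟨ν.1, Set.mem_Iic.2 (le_of_lt ν.2)⟩ ⟶
      MDSpace.chaotic c P (ULift.{u} ℝ) := MDSpace.toChaotic (up.comp (ContinuousMap.const _ 0))
  let f' : glob c P (Disk.{u} (X.dim ν)) ⟶ MDSpace.chaotic c P (ULift.{u} ℝ) :=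
    MDSpace.toChaotic (up.comp f)
  have w : X.attach ν ≫ zero = globMap c P (sphereIncl (X.dim ν)) ≫ f' :=
    MDSpace.Hom.ext (X := glob c P (Sphere.{u} (X.dim ν))) (Y := MDSpace.chaotic c P (ULift.{u} ℝ))
      (ContinuousMap.ext fun x => ULift.ext _ _ (hf x).symm)
  let d := (X.isPushout ν).desc zero f' w
  obtain ⟨g, hg⟩ := X.exists_extension
    ⟨Order.succ ν.1, Set.mem_Iic.2 (Order.succ_le_of_lt ν.2)⟩
    ((⟨ULift.down, continuous_uliftDown⟩ : C(ULift.{u} ℝ, ℝ)).comp (MDSpace.Hom.toMap d))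
  refine ⟨g, fun x => ?_, fun x => ?_⟩
  · rw [← X.toTotal_map (Subtype.mk_le_mk.2 (Order.le_succ ν.1)), hg]
    exact congrArg (fun f : X.functor.obj ⟨ν.1, Set.mem_Iic.2 (le_of_lt ν.2)⟩ ⟶
      MDSpace.chaotic c P (ULift.{u} ℝ) => (show ULift.{u} ℝ from MDSpace.Hom.toMap f x).down)
      ((X.isPushout ν).inl_desc zero f' w)
  · refine (hg _).trans ?_
    exact congrArg (fun f : glob c P (Disk.{u} (X.dim ν)) ⟶
      MDSpace.chaotic c P (ULift.{u} ℝ) => (show ULift.{u} ℝ from MDSpace.Hom.toMap f x).down)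
      ((X.isPushout ν).inr_desc zero f' w)

/-- A bump function equal to `1` at `x` and `0` on the globe of the sphere extends to `X_lam` by
zero on `X_ν`. -/
theorem cellMap_ne_toTotal {ν : Set.Iio lam} {x : GlobCarrier (Disk.{u} (X.dim ν))}
    (hx : x ∉ Set.range (GlobCarrier.map (sphereIncl (X.dim ν))))
    (y : (X.functor.obj ⟨ν.1, Set.mem_Iic.2 (le_of_lt ν.2)⟩).carrier) :
    MDSpace.Hom.toMap (X.cellMap ν) x ≠ MDSpace.Hom.toMap (X.toTotal _) y := by
  intro h
  obtain ⟨f, hf0, hf1, _⟩ := exists_continuous_zero_one_of_isClosed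
    (isClosedEmbedding_map_sphereIncl (X.dim ν)).isClosed_range isClosed_singleton
    (Set.disjoint_singleton_right.2 hx)
  obtain ⟨g, hg0, hg⟩ := X.exists_bump ν f fun z => hf0 ⟨z, rfl⟩
  have h1 := hg x
  rw [h, hg0, hf1 rfl] at h1
  exact zero_ne_one h1

/-- Here the bump function is also required to vanish at `y`. -/
theorem cellMap_injective_of_notMem_range {ν : Set.Iio lam} {x y : GlobCarrier (Disk.{u} (X.dim ν))}
    (hx : x ∉ Set.range (GlobCarrier.map (sphereIncl (X.dim ν))))
    (h : MDSpace.Hom.toMap (X.cellMap ν) x = MDSpace.Hom.toMap (X.cellMap ν) y) : x = y := by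
  by_contra hne
  obtain ⟨f, hf0, hf1, _⟩ := exists_continuous_zero_one_of_isClosed
    ((isClosedEmbedding_map_sphereIncl (X.dim ν)).isClosed_range.union
      (isClosed_singleton (x := y))) (isClosed_singleton (x := x))
    (Set.disjoint_singleton_right.2 (by rintro (h | h); exacts [hx h, hne h]))
  obtain ⟨g, -, hg⟩ := X.exists_bump ν f fun z => hf0 (Or.inl ⟨z, rfl⟩)
  have h1 : f x = f y := (hg x).symm.trans ((congrArg g h).trans (hg y))
  rw [hf0 (Or.inr rfl), hf1 rfl] at h1
  exact one_ne_zero h1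

theorem exists_toTotal_eq_cellMap {ν ν' : Set.Iio lam} (h : ν < ν')
    (x : GlobCarrier (Disk.{u} (X.dim ν))) :
    ∃ y, MDSpace.Hom.toMap (X.toTotal ⟨ν'.1, Set.mem_Iic.2 (le_of_lt ν'.2)⟩) y
      = MDSpace.Hom.toMap (X.cellMap ν) x :=
  ⟨_, X.toTotal_map (i := ⟨Order.succ ν.1, Set.mem_Iic.2 (Order.succ_le_of_lt ν.2)⟩)
    (Subtype.mk_le_mk.2 (Order.succ_le_of_lt h)) (MDSpace.Hom.toMap (X.char ν) x)⟩

/-! ### States and execution paths of a cellular space -/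

theorem isPathClosed_hasNaturalForm :
    MDSpace.IsPathClosed P {γ | HasNaturalForm P X.interiorPath γ} where
  reparam_mem _ h φ := h.reparam φ
  comp_mem _ h₁ _ h₂ h := h₁.normalizedComp h₂ h

/-- The states of `X_lam` come from `X_0`, and its execution paths have a natural form. -/
theorem mapsInto_toTotal (j : Set.Iic lam) : MDSpace.MapsInto (X.toTotal j)
    (Set.range (MDSpace.Hom.toMap (X.toTotal ⟨0, Set.mem_Iic.2 zero_le⟩)))
    {γ | HasNaturalForm P X.interiorPath γ} := by
  have hQ := X.isPathClosed_hasNaturalForm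
  obtain ⟨j, hj⟩ := j
  induction j using Ordinal.limitRecOn with
  | zero =>
    refine ⟨fun x _ => ⟨x, rfl⟩, fun γ hγ => ?_⟩
    rw [X.isDiscreteSet_zero.2.2] at hγ
    exact hγ.elim
  | add_one ν ih =>
    have hν : ν < lam := (Order.lt_succ ν).trans_le hj
    let ν' : Set.Iio lam := ⟨ν, hν⟩
    have ih := ih (le_of_lt hν)
    have hglob := X.cellMap_globMap ν'
    refine MDSpace.MapsInto.of_isPushout hQ (X.isPushout ν') ?_ ⟨?_, ?_⟩
    · exact (X.map_toTotal (Subtype.mk_le_mk.2 (Order.le_succ ν) :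
        (⟨ν, le_of_lt hν⟩ : Set.Iic lam) ≤ ⟨Order.succ ν, hj⟩)).symm ▸ ih
    -- The globe of a sphere, even of the empty one, has both states, so the states of the new globe
    -- are already images of states of `X_ν`.
    · have key : ∀ x ∈ (glob c P (Sphere.{u} (X.dim ν'))).states,
          MDSpace.Hom.toMap (X.cellMap ν') (GlobCarrier.map (sphereIncl (X.dim ν')) x) ∈
            Set.range (MDSpace.Hom.toMap (X.toTotal ⟨0, Set.mem_Iic.2 zero_le⟩)) := fun x hx => by
        have h1 := ih.states _ (MDSpace.Hom.map_states (X.attach ν') x hx)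
        have h2 := congrArg (fun f : glob c P (Sphere.{u} (X.dim ν')) ⟶ X.total =>
          MDSpace.Hom.toMap f x) hglob
        exact h2 ▸ h1
      rintro _ (rfl | rfl)
      · exact key GlobCarrier.initial (Or.inl rfl)
      · exact key GlobCarrier.final (Or.inr rfl)
    · rintro _ ⟨z, φ, rfl⟩
      by_cases hz : z ∈ Set.range (sphereIncl (X.dim ν'))
      · obtain ⟨z, rfl⟩ := hz
        have h1 := ih.paths _ (MDSpace.Hom.map_paths (X.attach ν')
          ((GlobCarrier.delta z).comp φ.1) ⟨z, φ, rfl⟩)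
        have h2 := congrArg (fun f : glob c P (Sphere.{u} (X.dim ν')) ⟶ X.total =>
          (MDSpace.Hom.toMap f).comp ((GlobCarrier.delta z).comp φ.1)) hglob
        exact h2 ▸ h1
      · exact hasNaturalForm_comp_hom (p := X.interiorPath) ⟨ν', z, hz⟩ φ
  | limit ν hν ih =>
    -- Being a limit is transferred from the ordinals to the initial segment `Set.Iic lam`, which
    -- indexes the tower.
    have hlim : Order.IsSuccLimit (⟨ν, hj⟩ : Set.Iic lam) := by
      refine ⟨fun h => hν.1 fun a ha => ?_, fun a ha => hν.2 a.1 ⟨ha.1, fun b hb hb' => ?_⟩⟩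
      · exact h (b := ⟨a, ha.trans hj⟩) ha
      · exact ha.2 (c := ⟨b, hb'.le.trans hj⟩) hb hb'
    have := X.continuous
    refine MDSpace.MapsInto.of_isColimit hQ
      (X.functor.isColimitOfIsWellOrderContinuous _ hlim) fun i => ?_
    exact (X.map_toTotal (le_of_lt i.2)).symm ▸ ih i.1.1 i.2 i.1.2

theorem exists_toTotal_eq_of_mem_states (j : Set.Iic lam) {x : X.total.carrier}
    (hx : x ∈ X.total.states) : ∃ y, MDSpace.Hom.toMap (X.toTotal j) y = x := by
  obtain ⟨y, hy⟩ := (X.mapsInto_toTotal ⟨lam, Set.mem_Iic.2 le_rfl⟩).states x hx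
  have h : MDSpace.Hom.toMap (X.toTotal ⟨lam, Set.mem_Iic.2 le_rfl⟩) x = x :=
    congrArg (fun f : X.total ⟶ X.total => MDSpace.Hom.toMap f x) (X.functor.map_id _)
  exact ⟨_, (X.toTotal_map (Subtype.mk_le_mk.2 zero_le) y).trans (hy.trans h)⟩

theorem hasNaturalForm {γ : C(unitInterval, X.total.carrier)} (hγ : γ ∈ X.total.paths) :
    HasNaturalForm P X.interiorPath γ := by
  have h1 := (X.mapsInto_toTotal ⟨lam, Set.mem_Iic.2 le_rfl⟩).paths γ hγ
  have h : (MDSpace.Hom.toMap (X.toTotal ⟨lam, Set.mem_Iic.2 le_rfl⟩)).comp γ = γ :=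
    congrArg (fun f : X.total ⟶ X.total => (MDSpace.Hom.toMap f).comp γ) (X.functor.map_id _)
  exact h ▸ h1

/-- The image of an earlier cell lies in the stage to which a later cell is attached, and the open
part of the later cell misses that stage. Within one cell, injectivity on the open part concludes.
-/
theorem separatesInterior : SeparatesInterior X.interiorPath := by
  rintro ⟨ν, z, hz⟩ ⟨ν', z', hz'⟩ s s' h0 h1 h
  have hr : GlobCarrier.mk z s ∉ Set.range (GlobCarrier.map (sphereIncl (X.dim ν))) :=
    fun hr => hz (GlobCarrier.mk_mem_range_map h0 h1 hr)
  change MDSpace.Hom.toMap (X.cellMap ν) (GlobCarrier.mk z s)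
    = MDSpace.Hom.toMap (X.cellMap ν') (GlobCarrier.mk z' s') at h
  rcases lt_trichotomy ν ν' with hlt | rfl | hlt
  · by_cases hs' : s' ≠ 0 ∧ s' ≠ 1
    · have hr' : GlobCarrier.mk z' s' ∉ Set.range (GlobCarrier.map (sphereIncl (X.dim ν'))) :=
        fun hr => hz' (GlobCarrier.mk_mem_range_map hs'.1 hs'.2 hr)
      obtain ⟨y, hy⟩ := X.exists_toTotal_eq_cellMap hlt (GlobCarrier.mk z s)
      exact absurd (h.symm.trans hy.symm) (X.cellMap_ne_toTotal hr' y)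
    -- The point of the later cell may be one of its two states. States come from `X_0`, hence from
    -- `X_ν`, which the open part of cell `ν` avoids.
    · have hst : GlobCarrier.mk z' s' ∈ (glob c P (Disk.{u} (X.dim ν'))).states := by
        by_cases hs0 : s' = 0
        · exact Or.inl (hs0 ▸ GlobCarrier.mk_zero z')
        · exact Or.inr (not_not.1 (fun hs1 => hs' ⟨hs0, hs1⟩) ▸ GlobCarrier.mk_one z')
      obtain ⟨y, hy⟩ := X.exists_toTotal_eq_of_mem_states ⟨ν.1, Set.mem_Iic.2 (le_of_lt ν.2)⟩
        (MDSpace.Hom.map_states (X.cellMap ν') _ hst)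
      exact absurd (h.trans hy.symm) (X.cellMap_ne_toTotal hr y)
  · obtain ⟨rfl, rfl⟩ := GlobCarrier.mk_eq_mk h0 h1 (X.cellMap_injective_of_notMem_range hr h)
    exact ⟨rfl, rfl⟩
  · obtain ⟨y, hy⟩ := X.exists_toTotal_eq_cellMap hlt (GlobCarrier.mk z' s')
    exact absurd (h.trans hy.symm) (X.cellMap_ne_toTotal hr y)

end CellularTower

/-! ### Assembly: uniqueness of the naturalization and of the carrier. -/

theorem MoorePath.ext_of_apply {U : Type*} [TopologicalSpace U] {N N' : MoorePath U}
    (hl : N.length = N'.length)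
    (h : ∀ (s : Seg N.length) (s' : Seg N'.length), (s : ℝ) = s' → N.toMap s = N'.toMap s') :
    N = N' := by
  obtain ⟨l, _, f, _⟩ := N
  obtain ⟨l', _, f', _⟩ := N'
  obtain rfl : l = l' := hl
  obtain rfl : f = f' := ContinuousMap.ext fun s => h s s rfl
  rfl

theorem mainTheorem8 (c : Convention) (P : Reparam) (lam : Ordinal.{w})
    (X : CellularTower.{w, u} c P lam) (γ : C(unitInterval, X.total.carrier))
    (hγ : γ ∈ X.total.paths) :
    (∃ n : ℕ, Nonempty (X.Decomposition γ n)) ∧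
    (∀ n n' : ℕ, Nonempty (X.Decomposition γ n) → Nonempty (X.Decomposition γ n') → n = n') ∧
    (∀ (n : ℕ) (d d' : X.Decomposition γ n), d.cell = d'.cell ∧ d.tensor = d'.tensor) ∧
    (∃ N : MoorePath X.total.carrier, X.IsNaturalization γ N ∧ N.IsRegular ∧
      ∀ N' : MoorePath X.total.carrier, X.IsNaturalization γ N' → N' = N) ∧
    (∃! l : List (Set.Iio lam), X.IsCarrier γ l) := by
  have hp := X.separatesInterior
  obtain ⟨n, _, _, _, _, h⟩ := X.hasNaturalForm hγ
  obtain ⟨d⟩ := CellularTower.nonempty_decomposition_of_isNaturalForm h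
  have hlength : ∀ n n' : ℕ, Nonempty (X.Decomposition γ n) → Nonempty (X.Decomposition γ n') →
      n = n' := by
    rintro n n' ⟨d⟩ ⟨d'⟩
    obtain ⟨_, _, _, h⟩ := d.exists_isNaturalForm
    obtain ⟨_, _, _, h'⟩ := d'.exists_isNaturalForm
    exact h.length_unique hp h'
  have hunique : ∀ (n : ℕ) (d d' : X.Decomposition γ n),
      d.cell = d'.cell ∧ d.tensor = d'.tensor := by
    intro n d d'
    obtain ⟨k, _, hk, h⟩ := d.exists_isNaturalForm
    obtain ⟨k', _, hk', h'⟩ := d'.exists_isNaturalForm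
    refine ⟨funext fun i => ?_, Subtype.ext (ContinuousMap.ext fun s => Subtype.ext ?_)⟩
    · rw [← hk, ← hk', h.index_unique hp h' i.2]
    · exact h.apply_eq hp h' s
  refine ⟨⟨n, ⟨d⟩⟩, hlength, hunique, ?_, ?_⟩
  · obtain ⟨k, _, hk, h⟩ := d.exists_isNaturalForm
    obtain ⟨N, hreg, hN, hNk⟩ := h.exists_moorePath hp
    refine ⟨N, ⟨n, d, by simp [hN], fun i t s hs => ?_⟩, hreg, ?_⟩
    · rw [partialSum_one] at hs
      rw [hNk i i.2 t s hs, hk]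
      rfl
    · rintro N' ⟨n', d', hN', hNk'⟩
      obtain rfl := hlength n' n ⟨d'⟩ ⟨d⟩
      have hl' : N'.length = n' := by simpa using hN'.symm
      refine MoorePath.ext_of_apply (hl'.trans hN.symm) fun s' s hs => ?_
      -- Both naturalizations are given on the `i`-th unit segment by the path of the `i`-th cell,
      -- and the cells of `d` and `d'` coincide.
      obtain ⟨i, hi, t, ht⟩ := exists_eq_natCast_add h.one_le s'.2.1 (s'.2.2.trans_eq hl')
      rw [hNk i hi t s (hs.symm.trans ht), hk ⟨i, hi⟩, (hunique n' d d').1]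
      exact hNk' ⟨i, hi⟩ t s' (by rw [partialSum_one]; exact ht)
  · refine ⟨List.ofFn fun i => (d.cell i).1, ⟨n, d, rfl⟩, ?_⟩
    rintro _ ⟨n', d', rfl⟩
    obtain rfl := hlength n' n ⟨d'⟩ ⟨d⟩
    rw [(hunique n' d d').1]
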